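/- **Model.** Consider a radial network: a finite rooted tree with nodes $0,1,\dots,I$, root (feeder) $0$, edges $\epsilon_{pk}$ ($p$ the parent of $k$) with resistance $R_{pk}\ge 0$ and reactance $X_{pk}\ge 0$, not both zero, and EV types $j=1,\dots,J$. Given are the feeder voltage $V_0$, voltage limits $0<\underline\upsilon_k<V_0^2\le\overline\upsilon_k$, numbers of parking spaces $K_i>0$, load limits $M_i>0$, maximal charging rates $c_j^{\max}>0$, arrival rates $\lambda_{ij}>0$, and random vectors $(B_j,D_j)$ (charging requirement, parking time) with $B_j,D_j>0$ a.s. and $\mathbb E D_j<\infty$. The utilities $u_{ij}:[0,\infty)\to[-\infty,\infty)$ are finite on $(0,\infty)$, strictly increasing and strictly concave on $[0,\infty)$, twice differentiable on $(0,\infty)$, with $u_{ij}'(0+)=\infty$. For $\Lambda\in\mathbb R_+^{I\times J}$ and real variables $W_{ii}$ ($0\le i\le I$), $W_{pk}=W_{kp}$ ($\epsilon_{pk}$ an edge) put $\mathbf W(\epsilon_{pk})=\begin{pmatrix}W_{pp}&W_{pk}\\W_{pk}&W_{kk}\end{pmatrix}$, $L_{ls}=(W_{ll}-2W_{ls}+W_{ss})/(R_{ls}^2+X_{ls}^2)$,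 and, with $\mathcal N(k),\mathcal E(k)$ the nodes and edges of the subtree rooted at $k$, $$P_{\mathcal N(k)}=\sum_{l\in\mathcal N(k)}\sum_j\Lambda_{lj}+\sum_{\epsilon_{ls}\in\mathcal E(k)}R_{ls}L_{ls},\qquad Q_{\mathcal N(k)}=\sum_{\epsilon_{ls}\in\mathcal E(k)}X_{ls}L_{ls}.$$ The *relaxed voltage constraints* on $(\Lambda,\mathbf W)$ are: $W_{00}=V_0^2$ and, for every edge $\epsilon_{pk}$, $W_{pk}-W_{kk}-P_{\mathcal N(k)}R_{pk}-Q_{\mathcal N(k)}X_{pk}=0$, $\underline\upsilon_k\le W_{kk}\le\overline\upsilon_k$, and $\mathbf W(\epsilon_{pk})\succeq0$. For $z\in\mathbb R_+^{I\times J}$ the charging rates $p(z)=(p_{ij}(z))$ maximize $\sum_{i,j}z_{ij}u_{ij}(p_{ij})$ over $(p,\mathbf W)$ subject to $\sum_jz_{ij}p_{ij}\le M_i$, $0\le p_{ij}\le c_j^{\max}$, the relaxed voltage constraints with $\Lambda_{ij}=z_{ij}p_{ij}$, and $\operatorname{rank}\mathbf W(\epsilon_{pk})=1$ for all edges; $p_{ij}(z)=0$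 where $z_{ij}=0$. A continuous $z:[0,\infty)\to\mathbb R_+^{I\times J}$ is a *fluid-model solution* if, for some $q_{ij}$ with $q_{ij}(0)\ge0$ and some initial random vectors $(B^0_{ij},D^0_{ij})$, for all $i,j\ge1$, $t\ge0$, $$z_{ij}(t)=z_{ij}(0)\,\mathbb P\Big(B^0_{ij}>\int_0^tp_{ij}(z(v))\,dv,\ D^0_{ij}\ge t\Big)+\int_0^t\gamma_{ij}(s)\,\mathbb P\Big(B_j>\int_s^tp_{ij}(z(v))\,dv,\ D_j\ge t-s\Big)ds,$$ $$q_{ij}(t)=q_{ij}(0)\,\mathbb P(D^0_{ij}\ge t)+\int_0^t\gamma_{ij}(s)\,\mathbb P(D_j\ge t-s)\,ds,\qquad \gamma_{ij}(t)=\lambda_{ij}\mathbf 1\Big\{\sum_{j'}q_{ij'}(t)<K_i\Big\}.$$ A vector $z^*$ is an *invariant point* if $z(t)\equiv z^*$ is a fluid-model solution. Put $\lambda_i=\sum_j\lambda_{ij}$, $$\gamma_{ij}=\frac{\lambda_{ij}}{\lambda_i}\min\Big\{\lambda_i,\ K_i\Big(\sum_{j'}\frac{\lambda_{ij'}}{\lambda_i}\mathbb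 E D_{j'}\Big)^{-1}\Big\},\qquad g_{ij}(x)=\gamma_{ij}\,\mathbb E\min\{D_jx,B_j\}.$$ **Theorem.** (i) Every invariant point $z^*$ satisfies, for all $i,j\ge1$ (with $B_j/0=\infty$), $$z^*_{ij}=\gamma_{ij}\,\mathbb E\Big[\min\Big\{D_j,\frac{B_j}{p_{ij}(z^*)}\Big\}\Big].\qquad(*)$$ (ii) Suppose that for every $j$ the leftmost point $\inf(D_j/B_j)$ of the support of $D_j/B_j$ is at most $1/c_j^{\max}$. Let $g_{ij}^{-1}$ denote the inverse of $g_{ij}:[0,c_j^{\max}]\to[0,g_{ij}(c_j^{\max})]$. There are functions $G_{ij}:[0,g_{ij}(c_j^{\max})]\to[-\infty,\infty)$, finite except possibly at $0$ and continuous, with $G_{ij}'=u_{ij}'\circ g_{ij}^{-1}$ on $(0,g_{ij}(c_j^{\max}))$. For any such $G_{ij}$: each $G_{ij}$ is strictly concave; the problem of maximizing $\sum_{i,j}G_{ij}(\Lambda_{ij})$ over $(\Lambda,\mathbf W)$ subject to the relaxed voltage constraints, $\sum_j\Lambda_{ij}\le M_i$ and $0\le\Lambda_{ij}\le g_{ij}(c_j^{\max})$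 has a solution, with a unique $\Lambda$-part $\Lambda^*$; and $(*)$ has a unique solution $z^*\in\mathbb R_+^{I\times J}$, namely $$z^*_{ij}=\frac{\Lambda^*_{ij}}{g_{ij}^{-1}(\Lambda^*_{ij})}.$$ -/

import Mathlib

open MeasureTheory Set Filter Topology

noncomputable section

namespace EVCharging

/-- The primitive data of the model. `N` is the (finite) set of nodes other than the feeder and `T`
the (finite) set of EV types. The set of all nodes is `Option N`, with `none` the feeder (root).
The edge that joins `k : N` to its parent is indexed by `k`. -/
structure Network (N T : Type*) where
  /-- the parent of a node; `none` is the feeder -/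
  parent : N → Option N
  /-- resistance of the edge from `parent k` to `k` -/
  R : N → ℝ
  /-- reactance of the edge from `parent k` to `k` -/
  X : N → ℝ
  /-- voltage at the feeder -/
  V₀ : ℝ
  /-- lower and upper limits on the squared voltage -/
  vlo : N → ℝ
  vhi : N → ℝ
  /-- number of parking spaces -/
  K : N → ℝ
  /-- maximal power that the parking lot at a node can consume -/
  M : N → ℝ
  /-- maximal charging rate -/
  cmax : T → ℝ
  /-- arrival rates -/
  lam : N → T → ℝ
  /-- joint law of (charging requirement, parking time) `(B_j, D_j)` -/
  F : T → Measure (ℝ × ℝ)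
  /-- utility functions; only the values on `[0, ∞)` matter, and the value at `0` may be `-∞`
  (as for the logarithm) -/
  u : N → T → ℝ → EReal

/-- Strict concavity on `s` of an extended-real-valued function. -/
def StrictConcaveOnE (s : Set ℝ) (f : ℝ → EReal) : Prop :=
  ∀ x ∈ s, ∀ y ∈ s, x ≠ y → ∀ a b : ℝ, 0 < a → 0 < b → a + b = 1 →
    (a : EReal) * f x + (b : EReal) * f y < f (a * x + b * y)

/-- Derivative of an extended-real-valued function at a point near which it is finite. -/
def derivE (f : ℝ → EReal) (x : ℝ) : ℝ := deriv (fun y => (f y).toReal) x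

/-- The requirements on a utility function: strictly increasing and strictly concave on `[0, ∞)`,
finite and twice differentiable on `(0, ∞)`, with infinite slope at `0`. -/
structure IsUtility (u : ℝ → EReal) : Prop where
  strictMono : StrictMonoOn u (Ici 0)
  strictConcave : StrictConcaveOnE (Ici 0) u
  finite : ∀ x : ℝ, 0 < x → u x ≠ ⊥ ∧ u x ≠ ⊤
  diff : ∀ x : ℝ, 0 < x → DifferentiableAt ℝ (fun y => (u y).toReal) x
  diff₂ : ∀ x : ℝ, 0 < x → DifferentiableAt ℝ (derivE u) x
  slope : Tendsto (derivE u) (𝓝[>] 0) atTop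

/-- The leftmost point of the support of a distribution on the real line. -/
def leftmost (μ : Measure ℝ) : ℝ := sInf μ.support

namespace Network

variable {N T : Type*}

/-- The standing assumptions of the model. -/
structure Standing (𝒩 : Network N T) : Prop where
  /-- following parents one always ends at the feeder: the graph is a rooted tree -/
  tree : WellFounded (fun a b : N => 𝒩.parent b = some a)
  R_nonneg : ∀ k, 0 ≤ 𝒩.R k
  X_nonneg : ∀ k, 0 ≤ 𝒩.X k
  impedance : ∀ k, 𝒩.R k ≠ 0 ∨ 𝒩.X k ≠ 0
  vlo_pos : ∀ k, 0 < 𝒩.vlo k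
  vlo_lt : ∀ k, 𝒩.vlo k < 𝒩.V₀ ^ 2
  le_vhi : ∀ k, 𝒩.V₀ ^ 2 ≤ 𝒩.vhi k
  K_pos : ∀ i, 0 < 𝒩.K i
  M_pos : ∀ i, 0 < 𝒩.M i
  cmax_pos : ∀ j, 0 < 𝒩.cmax j
  lam_pos : ∀ i j, 0 < 𝒩.lam i j
  prob : ∀ j, IsProbabilityMeasure (𝒩.F j)
  B_pos : ∀ j, ∀ᵐ x ∂𝒩.F j, 0 < x.1
  D_pos : ∀ j, ∀ᵐ x ∂𝒩.F j, 0 < x.2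
  D_integrable : ∀ j, Integrable (fun x : ℝ × ℝ => x.2) (𝒩.F j)
  utility : ∀ i j, IsUtility (𝒩.u i j)

/-- The variables `W_ii` (`diag`) and `W_pk`, `p` the parent of `k` (`off k`). -/
structure WVar (N : Type*) where
  diag : Option N → ℝ
  off : N → ℝ

/-- The symmetric matrix `W(ε_pk)` of the edge from the parent `p` of `k` to `k`. -/
def edgeMatrix (𝒩 : Network N T) (W : WVar N) (k : N) : Matrix (Fin 2) (Fin 2) ℝ :=
  !![W.diag (𝒩.parent k), W.off k; W.off k, W.diag (some k)]

/-- Active power loss on the edge above `s`. -/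
def lossP (𝒩 : Network N T) (W : WVar N) (s : N) : ℝ :=
  (W.diag (𝒩.parent s) - 2 * W.off s + W.diag (some s)) * 𝒩.R s / (𝒩.R s ^ 2 + 𝒩.X s ^ 2)

/-- Reactive power loss on the edge above `s`. -/
def lossQ (𝒩 : Network N T) (W : WVar N) (s : N) : ℝ :=
  (W.diag (𝒩.parent s) - 2 * W.off s + W.diag (some s)) * 𝒩.X s / (𝒩.R s ^ 2 + 𝒩.X s ^ 2)

section Finite

variable [Fintype N] [Fintype T]

open Classical in
/-- The nodes of the subtree rooted at `k`: those reached from `k` by going to children. -/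
def subtree (𝒩 : Network N T) (k : N) : Finset N :=
  Finset.univ.filter (fun l => Relation.ReflTransGen (fun a b : N => 𝒩.parent b = some a) k l)

open Classical in
/-- The children of a node. -/
def children (𝒩 : Network N T) (l : N) : Finset N :=
  Finset.univ.filter (fun s => 𝒩.parent s = some l)

/-- Active power consumed by the subtree rooted at `k`, when type-`j` EVs at node `l` together
consume `Λ l j`. -/
def powerP (𝒩 : Network N T) (Λ : N → T → ℝ) (W : WVar N) (k : N) : ℝ :=
  ∑ l ∈ 𝒩.subtree k, ∑ j, Λ l j + ∑ l ∈ 𝒩.subtree k, ∑ s ∈ 𝒩.children l, 𝒩.lossP W s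

/-- Reactive power consumed by the subtree rooted at `k`. -/
def powerQ (𝒩 : Network N T) (W : WVar N) (k : N) : ℝ :=
  ∑ l ∈ 𝒩.subtree k, ∑ s ∈ 𝒩.children l, 𝒩.lossQ W s

/-- The voltage constraints without the rank condition: Kirchhoff's law, voltage limits, and
positive semidefiniteness of the edge matrices. -/
structure VoltageFeasible (𝒩 : Network N T) (Λ : N → T → ℝ) (W : WVar N) : Prop where
  feeder : W.diag none = 𝒩.V₀ ^ 2
  kirchhoff : ∀ k, W.off k - W.diag (some k) - 𝒩.powerP Λ W k * 𝒩.R k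
    - 𝒩.powerQ W k * 𝒩.X k = 0
  lower : ∀ k, 𝒩.vlo k ≤ W.diag (some k)
  upper : ∀ k, W.diag (some k) ≤ 𝒩.vhi k
  psd : ∀ k, (𝒩.edgeMatrix W k).PosSemidef

/-! ### The charging control rule -/

/-- Feasible charging rates `p` in state `z`, under the AC voltage model (with rank-one edge
matrices). -/
structure RateFeasible (𝒩 : Network N T) (z p : N → T → ℝ) : Prop where
  load : ∀ i, ∑ j, z i j * p i j ≤ 𝒩.M i
  nonneg : ∀ i j, 0 ≤ p i j
  le_cmax : ∀ i j, p i j ≤ 𝒩.cmax j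
  voltage : ∃ W : WVar N, 𝒩.VoltageFeasible (fun i j => z i j * p i j) W ∧
    ∀ k, (𝒩.edgeMatrix W k).rank = 1

/-- The aggregate utility; in `EReal`, `0 * (-∞) = 0`. -/
def rateObjective (𝒩 : Network N T) (z p : N → T → ℝ) : EReal :=
  ∑ i, ∑ j, (z i j : EReal) * 𝒩.u i j (p i j)

/-- `p` is the charging-rate vector in state `z`: an optimal feasible vector, with
`p i j = 0` where `z i j = 0`. -/
structure IsChargingRate (𝒩 : Network N T) (z p : N → T → ℝ) : Prop where
  feasible : 𝒩.RateFeasible z p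
  zero : ∀ i j, z i j = 0 → p i j = 0
  optimal : ∀ p', 𝒩.RateFeasible z p' → 𝒩.rateObjective z p' ≤ 𝒩.rateObjective z p

/-- The charging control rule `z ↦ p(z)`. -/
def rate (𝒩 : Network N T) (z : N → T → ℝ) : N → T → ℝ :=
  Classical.epsilon (fun p => 𝒩.IsChargingRate z p)

/-! ### The fluid model -/

/-- Total number of EVs at node `i`. -/
def total (q : ℝ → N → T → ℝ) (i : N) (t : ℝ) : ℝ := ∑ j, q t i j

open Classical in
/-- The admission rate `λ_ij 1{q_i(t) < K_i}`. -/
def admission (𝒩 : Network N T) (q : ℝ → N → T → ℝ) (i : N) (j : T) (t : ℝ) : ℝ :=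
  if total q i t < 𝒩.K i then 𝒩.lam i j else 0

/-- `z` is a fluid-model solution, where `q` gives the total numbers of EVs and `F₀ i j` is the
joint law of (charging requirement, parking time) of the initial type-`j` EVs at node `i`. -/
structure IsFluidSolution (𝒩 : Network N T) (F₀ : N → T → Measure (ℝ × ℝ))
    (q z : ℝ → N → T → ℝ) : Prop where
  nonneg : ∀ t, 0 ≤ t → ∀ i j, 0 ≤ z t i j
  continuous : ∀ i j, ContinuousOn (fun t => z t i j) (Ici 0)
  rate_integrable : ∀ i j t, 0 ≤ t →
    IntervalIntegrable (fun s => 𝒩.rate (z s) i j) volume 0 t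
  q_init : ∀ i j, 0 ≤ q 0 i j
  q_measurable : ∀ i j, Measurable (fun t => q t i j)
  q_eq : ∀ t, 0 ≤ t → ∀ i j,
    q t i j = q 0 i j * (F₀ i j).real {x | t ≤ x.2}
      + ∫ s in (0 : ℝ)..t, 𝒩.admission q i j s * (𝒩.F j).real {x | t - s ≤ x.2}
  z_eq : ∀ t, 0 ≤ t → ∀ i j,
    z t i j
      = z 0 i j * (F₀ i j).real {x | (∫ v in (0 : ℝ)..t, 𝒩.rate (z v) i j) < x.1 ∧ t ≤ x.2}
      + ∫ s in (0 : ℝ)..t, 𝒩.admission q i j s *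
          (𝒩.F j).real {x | (∫ v in s..t, 𝒩.rate (z v) i j) < x.1 ∧ t - s ≤ x.2}

/-- `z` is an invariant point: the constant function `z` is a fluid-model solution, for some
initial total population and initial laws. -/
def IsInvariantPoint (𝒩 : Network N T) (z : N → T → ℝ) : Prop :=
  ∃ (F₀ : N → T → Measure (ℝ × ℝ)) (q : ℝ → N → T → ℝ),
    (∀ i j, IsProbabilityMeasure (F₀ i j)) ∧ 𝒩.IsFluidSolution F₀ q (fun _ => z)

/-! ### The fixed-point equation and the optimal power flow problem -/

/-- Mean parking time. -/
def meanD (𝒩 : Network N T) (j : T) : ℝ := ∫ x, x.2 ∂𝒩.F j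

/-- Total arrival rate at a node. -/
def lamTot (𝒩 : Network N T) (i : N) : ℝ := ∑ j, 𝒩.lam i j

/-- The modified arrival rate `γ_ij`. -/
def gam (𝒩 : Network N T) (i : N) (j : T) : ℝ :=
  𝒩.lam i j / 𝒩.lamTot i *
    min (𝒩.lamTot i) (𝒩.K i * (∑ j', 𝒩.lam i j' / 𝒩.lamTot i * 𝒩.meanD j')⁻¹)

/-- `min {d, b / p}`, where `b / 0 = ∞`. -/
def sojourn (b d p : ℝ) : ℝ := if p = 0 then d else min d (b / p)

/-- `z ≥ 0` solves `z_ij = γ_ij E[min {D_j, B_j / p_ij(z)}]`. -/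
def IsFixedPoint (𝒩 : Network N T) (z : N → T → ℝ) : Prop :=
  (∀ i j, 0 ≤ z i j) ∧
    ∀ i j, z i j = 𝒩.gam i j * ∫ x, sojourn x.1 x.2 (𝒩.rate z i j) ∂𝒩.F j

/-- `g_ij(x) = γ_ij E[min {D_j x, B_j}]`. -/
def g (𝒩 : Network N T) (i : N) (j : T) (x : ℝ) : ℝ :=
  𝒩.gam i j * ∫ y, min (y.2 * x) y.1 ∂𝒩.F j

/-- The inverse of `g_ij : [0, c_j^max] → [0, g_ij(c_j^max)]`. -/
def gInv (𝒩 : Network N T) (i : N) (j : T) : ℝ → ℝ :=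
  Function.invFunOn (𝒩.g i j) (Icc 0 (𝒩.cmax j))

/-- `G` is a function on `[0, g_ij(c_j^max)]` with `G' = u_ij' ∘ g_ij⁻¹`: finite and continuous
except that the value at `0`, which is the limit there, may be `-∞`. -/
structure IsPrimitive (𝒩 : Network N T) (i : N) (j : T) (G : ℝ → EReal) : Prop where
  finite : ∀ y ∈ Ioc 0 (𝒩.g i j (𝒩.cmax j)), G y ≠ ⊥ ∧ G y ≠ ⊤
  continuous : ContinuousOn G (Icc 0 (𝒩.g i j (𝒩.cmax j)))
  hasDeriv : ∀ y ∈ Ioo 0 (𝒩.g i j (𝒩.cmax j)),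
    HasDerivAt (fun y => (G y).toReal) (derivE (𝒩.u i j) (𝒩.gInv i j y)) y

/-- Feasible points of the relaxed optimal power flow problem. -/
structure OPFFeasible (𝒩 : Network N T) (Λ : N → T → ℝ) (W : WVar N) : Prop where
  voltage : 𝒩.VoltageFeasible Λ W
  load : ∀ i, ∑ j, Λ i j ≤ 𝒩.M i
  nonneg : ∀ i j, 0 ≤ Λ i j
  le_max : ∀ i j, Λ i j ≤ 𝒩.g i j (𝒩.cmax j)

/-- `Λ` solves the relaxed optimal power flow problem with objective `∑ G_ij(Λ_ij)`: it is the
`Λ`-part of an optimal pair `(Λ, W)`. -/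
def IsOPFSolution (𝒩 : Network N T) (G : N → T → ℝ → EReal) (Λ : N → T → ℝ) : Prop :=
  (∃ W, 𝒩.OPFFeasible Λ W) ∧
    ∀ Λ' W', 𝒩.OPFFeasible Λ' W' → ∑ i, ∑ j, G i j (Λ' i j) ≤ ∑ i, ∑ j, G i j (Λ i j)

end Finite

end Network

end EVCharging

end

noncomputable section

/-! Invariant points. In a constant state the charging rates are constant, so the state equation
writes `z` as a vanishing term from the initial EVs plus `lam` times the convolution of the
admission indicator with the survival function of the time spent uncharged. The admission indicator
need not converge, so long-run averages are taken: the average of a convolution is asymptotically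
the average of its first factor times the integral of its second (`tendsto_average_conv_sub`). The
admitted fraction of time is `min 1 (K / ρ)` with `ρ = ∑ lam * E D`
(`EVCharging.tendsto_average_admission`): either the lot is eventually never full and arrivals
always enter, or the admitted population converges to `K`, and averaging gives `K = ρ * (admitted
fraction)`. This fraction is `gam / lam`.

Fixed points and optimal power flow. The rank condition in the charging problem is nonconvex but
harmless: among all flows that serve given loads, one of least total squared current has rank-one
edge matrices (`exists_rank_one`). Hence charging rates maximize a concave function over a compact
convex set, described by the convex set `loadSet`. Infinite marginals at `0` keep maximizers off the
coordinate hyperplanes, so they are characterized by a first-order variational inequality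
(`exists_strict_maximizer`), although objectives may be `-∞` or jump at `0`.

In the load variables `y = z p` the charging problem has gradient `u'(p)`, and the power flow
problem has gradient `u'(g⁻¹(Λ))` at `Λ`. The fixed-point equation says exactly `z p = g(p)`,
because `p * E min(D, B/p) = E min(D p, B)`. With `Λ = z p` the gradients then coincide. The upper
bounds `z * cmax` and `g(cmax)` differ, but they bind in the same coordinates, and a first-order
condition sees only the binding bounds (`firstOrder_of_box`). So the two optimality conditions are
equivalent (`rate_eq_iff_opf`), and existence and uniqueness pass from `Λ` to `z`. The support
hypothesis is what makes `g` injective on `[0, cmax]`. -/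

namespace EVCharging

/-! ### Extended-real concave functions and their marginals. -/

/-- A concave function on `[0, c]`, finite on `(0, c]`, together with its marginal `φ`, which is
infinite at `0`. The function may be discontinuous, or equal to `-∞`, at `0`. -/
structure IsMarginal (c : ℝ) (f : ℝ → EReal) (φ : ℝ → ℝ) : Prop where
  pos : 0 < c
  coe : ∀ x ∈ Ioc 0 c, ((f x).toReal : EReal) = f x
  tangent : ∀ x ∈ Ioc 0 c, ∀ y ∈ Icc 0 c, y ≠ x →
    f y < (((f x).toReal + φ x * (y - x) : ℝ) : EReal)
  cont : ContinuousOn (fun x => (f x).toReal) (Ioc 0 c)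
  cont_marginal : ContinuousOn φ (Ioc 0 c)
  nonneg : ∀ x ∈ Ioc 0 c, 0 ≤ φ x
  anti : AntitoneOn φ (Ioc 0 c)
  slope : Tendsto φ (𝓝[>] 0) atTop

theorem IsMarginal.le_tangent {c : ℝ} {f : ℝ → EReal} {φ : ℝ → ℝ} (h : IsMarginal c f φ)
    {x y : ℝ} (hx : x ∈ Ioc 0 c) (hy : y ∈ Icc 0 c) :
    f y ≤ (((f x).toReal + φ x * (y - x) : ℝ) : EReal) := by
  rcases eq_or_ne y x with rfl | hne
  · simp [h.coe y hx]
  · exact (h.tangent x hx y hy hne).le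

/-- The tangent inequality between positive points, from a strictly decreasing derivative. -/
theorem lt_tangent_of_hasDerivAt {c : ℝ} {F φ : ℝ → ℝ} (hcont : ContinuousOn F (Ioc 0 c))
    (hd : ∀ x ∈ Ioo 0 c, HasDerivAt F (φ x) x) (hφ : StrictAntiOn φ (Ioc 0 c))
    {x y : ℝ} (hx : x ∈ Ioc 0 c) (hy : y ∈ Ioc 0 c) (hne : y ≠ x) :
    F y < F x + φ x * (y - x) := by
  rcases lt_or_gt_of_ne hne with hlt | hlt
  · obtain ⟨ξ, hξ, e⟩ := exists_hasDerivAt_eq_slope F φ hlt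
      (hcont.mono fun s hs => ⟨hy.1.trans_le hs.1, hs.2.trans hx.2⟩)
      (fun s hs => hd s ⟨hy.1.trans hs.1, hs.2.trans_le hx.2⟩)
    have h1 : φ x < φ ξ := hφ ⟨hy.1.trans hξ.1, hξ.2.le.trans hx.2⟩ hx hξ.2
    rw [eq_div_iff (by linarith)] at e
    nlinarith
  · obtain ⟨ξ, hξ, e⟩ := exists_hasDerivAt_eq_slope F φ hlt
      (hcont.mono fun s hs => ⟨hx.1.trans_le hs.1, hs.2.trans hy.2⟩)
      (fun s hs => hd s ⟨hx.1.trans hs.1, hs.2.trans_le hy.2⟩)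
    have h1 : φ ξ < φ x := hφ hx ⟨hx.1.trans hξ.1, hξ.2.le.trans hy.2⟩ hξ.1
    rw [eq_div_iff (by linarith)] at e
    nlinarith

/-- Only the strict tangent inequality at the endpoint `y = 0` goes beyond the mean value theorem.
No continuity at `0` is needed: `f 0` lies below all nearby values, which suffices for an upper
bound. -/
theorem IsMarginal.of_hasDerivAt {c : ℝ} {f : ℝ → EReal} {φ : ℝ → ℝ} (hc : 0 < c)
    (hfin : ∀ x ∈ Ioc 0 c, f x ≠ ⊥ ∧ f x ≠ ⊤) (h0 : ∀ x ∈ Ioc 0 c, f 0 ≤ f x)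
    (hcont : ContinuousOn (fun x => (f x).toReal) (Ioc 0 c))
    (hd : ∀ x ∈ Ioo 0 c, HasDerivAt (fun x => (f x).toReal) (φ x) x)
    (hφ : StrictAntiOn φ (Ioc 0 c)) (hφc : ContinuousOn φ (Ioc 0 c))
    (hφ0 : ∀ x ∈ Ioc 0 c, 0 ≤ φ x) (hs : Tendsto φ (𝓝[>] 0) atTop) : IsMarginal c f φ := by
  have hcoe : ∀ x ∈ Ioc 0 c, ((f x).toReal : EReal) = f x := fun x hx =>
    EReal.coe_toReal (hfin x hx).2 (hfin x hx).1
  refine ⟨hc, hcoe, ?_, hcont, hφc, hφ0, hφ.antitoneOn, hs⟩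
  intro x hx y hy hne
  have key := fun {x y : ℝ} hx hy hne =>
    lt_tangent_of_hasDerivAt (F := fun x => (f x).toReal) (x := x) (y := y) hcont hd hφ hx hy hne
  rcases hy.1.eq_or_lt with rfl | hpos
  -- Passing to the limit `s → 0` gives only a weak inequality, so it is done for the tangent at `x
  -- / 2`; that tangent lies strictly below the tangent at `x` when both are evaluated at `0`.
  · have hm : x / 2 ∈ Ioc 0 c := ⟨by linarith [hx.1], by linarith [hx.1, hx.2]⟩
    have hlim : Tendsto (fun s : ℝ => (((f (x / 2)).toReal + φ (x / 2) * (s - x / 2) : ℝ) : EReal))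
        (𝓝[>] 0) (𝓝 (((f (x / 2)).toReal + φ (x / 2) * (0 - x / 2) : ℝ) : EReal)) := by
      apply (continuous_coe_real_ereal.tendsto _).comp
      apply Tendsto.mono_left _ nhdsWithin_le_nhds
      exact Continuous.tendsto (by fun_prop) _
    have h1 : f 0 ≤ (((f (x / 2)).toReal + φ (x / 2) * (0 - x / 2) : ℝ) : EReal) := by
      refine ge_of_tendsto hlim ?_
      filter_upwards [Ioo_mem_nhdsGT hm.1] with s hs
      have hs' : s ∈ Ioc 0 c := ⟨hs.1, hs.2.le.trans hm.2⟩
      refine (h0 s hs').trans ?_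
      rw [← hcoe s hs']
      exact EReal.coe_le_coe_iff.2 (key hm hs' hs.2.ne).le
    refine h1.trans_lt (EReal.coe_lt_coe_iff.2 ?_)
    have h2 := key hx hm (by linarith [hx.1])
    have h3 := hφ hm hx (by linarith [hx.1])
    have := hx.1
    nlinarith
  · have hy' : y ∈ Ioc 0 c := ⟨hpos, hy.2⟩
    rw [← hcoe y hy']
    exact EReal.coe_lt_coe_iff.2 (key hx hy' hne)

/-- Rescaling by a positive weight. -/
theorem IsMarginal.const_mul {c : ℝ} {f : ℝ → EReal} {φ : ℝ → ℝ} (h : IsMarginal c f φ)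
    {w : ℝ} (hw : 0 < w) : IsMarginal c (fun x => (w : EReal) * f x) (fun x => w * φ x) := by
  have htr : ∀ x, ((w : EReal) * f x).toReal = w * (f x).toReal := fun x => by
    rw [EReal.toReal_mul, EReal.toReal_coe]
  refine ⟨h.pos, ?_, ?_, ?_, ?_, ?_, ?_, ?_⟩
  · intro x hx
    rw [htr, EReal.coe_mul, h.coe x hx]
  · intro x hx y hy hne
    have := h.tangent x hx y hy hne
    rw [htr]
    have e : w * (f x).toReal + w * φ x * (y - x) = w * ((f x).toReal + φ x * (y - x)) := by ring
    rw [e, EReal.coe_mul]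
    generalize ((f x).toReal + φ x * (y - x)) = r at this
    induction hf : f y with
    | bot => rw [EReal.coe_mul_bot_of_pos hw, ← EReal.coe_mul]; exact EReal.bot_lt_coe _
    | coe a =>
      rw [hf, EReal.coe_lt_coe_iff] at this
      rw [← EReal.coe_mul, ← EReal.coe_mul, EReal.coe_lt_coe_iff]
      exact mul_lt_mul_of_pos_left this hw
    | top => rw [hf] at this; exact absurd this (by simp)
  · simp only [htr]
    exact continuousOn_const.mul h.cont
  · exact continuousOn_const.mul h.cont_marginal
  · exact fun x hx => mul_nonneg hw.le (h.nonneg x hx)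
  · exact fun x hx y hy hxy => mul_le_mul_of_nonneg_left (h.anti hx hy hxy) hw.le
  · exact h.slope.const_mul_atTop hw

/-- Both endpoints lie strictly below the tangent at the convex combination, and the linear terms
cancel in the weighted sum. The tangent exists because at most one of two distinct points of `[0,
c]` is `0`, so the combination is positive. -/
theorem IsMarginal.strictConcaveOnE {c : ℝ} {f : ℝ → EReal} {φ : ℝ → ℝ} (h : IsMarginal c f φ) :
    StrictConcaveOnE (Icc 0 c) f := by
  intro x hx y hy hne a b ha hb hab
  have hm : a * x + b * y ∈ Ioc 0 c := by
    have hsum : a * x + b * y ≤ c :=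
      (convex_Icc 0 c hx hy ha.le hb.le hab).2
    refine ⟨?_, hsum⟩
    rcases hx.1.eq_or_lt with h0 | h0
    · have : 0 < y := lt_of_le_of_ne hy.1 (by rw [h0]; exact hne)
      nlinarith [mul_pos hb this]
    · nlinarith [mul_pos ha h0, mul_nonneg hb.le hy.1]
  have hb' : b = 1 - a := by linarith
  have hxm : x ≠ a * x + b * y := by
    intro e
    apply hne
    have : b * (x - y) = 0 := by subst hb'; linarith
    rcases mul_eq_zero.1 this with h | h <;> linarith
  have hym : y ≠ a * x + b * y := by
    intro e
    apply hne
    have : a * (x - y) = 0 := by subst hb'; linarith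
    rcases mul_eq_zero.1 this with h | h <;> linarith
  have h1 := (h.const_mul ha).tangent _ hm x hx hxm
  have h2 := (h.const_mul hb).tangent _ hm y hy hym
  have h3 := EReal.add_lt_add h1 h2
  refine h3.trans_eq ?_
  rw [← EReal.coe_add, ← h.coe _ hm]
  simp only [EReal.toReal_mul, EReal.toReal_coe]
  rw [EReal.coe_eq_coe_iff]
  subst hb'
  ring

theorem ereal_coe_sum {ι : Type*} (s : Finset ι) (r : ι → ℝ) :
    ((∑ i ∈ s, r i : ℝ) : EReal) = ∑ i ∈ s, (r i : EReal) := by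
  classical
  induction s using Finset.induction_on with
  | empty => simp
  | insert a s ha ih => rw [Finset.sum_insert ha, Finset.sum_insert ha, EReal.coe_add, ih]

/-! ### Maximizing separable concave sums over a convex set. -/

section Optimization

variable {ι : Type*} [Fintype ι]

theorem sum_le_coe_sum {a : ι → EReal} {r : ι → ℝ} (h : ∀ i, a i ≤ r i) :
    ∑ i, a i ≤ ((∑ i, r i : ℝ) : EReal) := by
  rw [ereal_coe_sum]
  exact Finset.sum_le_sum fun i _ => h i

theorem sum_lt_coe_sum {a : ι → EReal} {r : ι → ℝ} (h : ∀ i, a i ≤ r i) {k : ι}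
    (hk : a k < r k) : ∑ i, a i < ((∑ i, r i : ℝ) : EReal) := by
  classical
  rw [← Finset.add_sum_erase _ _ (Finset.mem_univ k),
    ← Finset.add_sum_erase _ _ (Finset.mem_univ k)]
  have h1 : ∑ i ∈ Finset.univ.erase k, a i ≤ ((∑ i ∈ Finset.univ.erase k, r i : ℝ) : EReal) := by
    rw [ereal_coe_sum]
    exact Finset.sum_le_sum fun i _ => h i
  refine (add_le_add le_rfl h1).trans_lt ?_
  rw [EReal.coe_add]
  exact EReal.add_lt_add_right_coe hk _

variable {c : ι → ℝ} {f : ι → ℝ → EReal} {φ : ι → ℝ → ℝ}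

theorem coe_sum_toReal (hf : ∀ i, IsMarginal (c i) (f i) (φ i)) {x : ι → ℝ}
    (hx : ∀ i, x i ∈ Ioc 0 (c i)) :
    ((∑ i, (f i (x i)).toReal : ℝ) : EReal) = ∑ i, f i (x i) := by
  rw [ereal_coe_sum]
  exact Finset.sum_congr rfl fun i _ => (hf i).coe _ (hx i)

theorem sum_le_tangent (hf : ∀ i, IsMarginal (c i) (f i) (φ i)) {x y : ι → ℝ}
    (hx : ∀ i, x i ∈ Ioc 0 (c i)) (hy : ∀ i, y i ∈ Icc 0 (c i)) :
    ∑ i, f i (y i) ≤ ((∑ i, (f i (x i)).toReal + ∑ i, φ i (x i) * (y i - x i) : ℝ) : EReal) := by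
  rw [← Finset.sum_add_distrib]
  exact sum_le_coe_sum fun i => (hf i).le_tangent (hx i) (hy i)

/-- The first-order condition is sufficient, and makes the optimum strict. -/
theorem sum_lt_of_firstOrder (hf : ∀ i, IsMarginal (c i) (f i) (φ i)) {x y : ι → ℝ}
    (hx : ∀ i, x i ∈ Ioc 0 (c i)) (hy : ∀ i, y i ∈ Icc 0 (c i)) (hne : y ≠ x)
    (hfo : ∑ i, φ i (x i) * (y i - x i) ≤ 0) :
    ∑ i, f i (y i) < ∑ i, f i (x i) := by
  obtain ⟨k, hk⟩ := Function.ne_iff.1 hne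
  have h := sum_lt_coe_sum (fun i => (hf i).le_tangent (hx i) (hy i))
    ((hf k).tangent _ (hx k) _ (hy k) hk)
  refine h.trans_le ?_
  rw [← coe_sum_toReal hf hx, EReal.coe_le_coe_iff, Finset.sum_add_distrib]
  linarith

/-- The first-order condition is necessary. -/
theorem firstOrder_of_optimal (hf : ∀ i, IsMarginal (c i) (f i) (φ i)) {C : Set (ι → ℝ)}
    (hC : Convex ℝ C) (hbox : ∀ x ∈ C, ∀ i, x i ∈ Icc 0 (c i)) {x : ι → ℝ} (hxC : x ∈ C)
    (hx : ∀ i, 0 < x i) (hopt : ∀ y ∈ C, ∑ i, f i (y i) ≤ ∑ i, f i (x i)) {y : ι → ℝ}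
    (hy : y ∈ C) : ∑ i, φ i (x i) * (y i - x i) ≤ 0 := by
  have hx' : ∀ i, x i ∈ Ioc 0 (c i) := fun i => ⟨hx i, (hbox x hxC i).2⟩
  let w : ℝ → ι → ℝ := fun t => x + t • (y - x)
  have hw : ∀ t i, w t i = x i + t * (y i - x i) := fun t i => rfl
  have hwC : ∀ t ∈ Ioo (0 : ℝ) 1, w t ∈ C := fun t ht =>
    hC.add_smul_sub_mem hxC hy ⟨ht.1.le, ht.2.le⟩
  have hwI : ∀ t ∈ Ioo (0 : ℝ) 1, ∀ i, w t i ∈ Ioc 0 (c i) := by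
    intro t ht i
    refine ⟨?_, (hbox _ (hwC t ht) i).2⟩
    rw [hw]
    nlinarith [(hbox y hy i).1, ht.1, ht.2, hx i, mul_nonneg ht.1.le (hbox y hy i).1,
      mul_pos (sub_pos.2 ht.2) (hx i)]
  -- The tangent is taken at the moving point `w t` and evaluated at `x`. Optimality of `x` then
  -- leaves an inequality that can be divided by `t`, and the limit `t → 0` needs only continuity of
  -- the marginals.
  have hle : ∀ t ∈ Ioo (0 : ℝ) 1, ∑ i, φ i (w t i) * (y i - x i) ≤ 0 := by
    intro t ht
    have h1 := sum_le_tangent hf (hwI t ht) (fun i => Ioc_subset_Icc_self (hx' i))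
    have h2 := (hopt _ (hwC t ht)).trans h1
    rw [← coe_sum_toReal hf (hwI t ht), EReal.coe_le_coe_iff] at h2
    have h3 : ∑ i, φ i (w t i) * (x i - w t i) = -t * ∑ i, φ i (w t i) * (y i - x i) := by
      rw [Finset.mul_sum]
      refine Finset.sum_congr rfl fun i _ => ?_
      rw [hw t i]; ring
    rw [h3] at h2
    nlinarith [ht.1]
  have hlim : Tendsto (fun t => ∑ i, φ i (w t i) * (y i - x i)) (𝓝[>] 0)
      (𝓝 (∑ i, φ i (x i) * (y i - x i))) := by
    refine tendsto_finsetSum _ fun i _ => Tendsto.mul_const _ ?_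
    refine ((hf i).cont_marginal (x i) (hx' i)).tendsto.comp ?_
    refine tendsto_nhdsWithin_iff.2 ⟨?_, ?_⟩
    · have : Tendsto (fun t : ℝ => x i + t * (y i - x i)) (𝓝 0) (𝓝 (x i + 0 * (y i - x i))) :=
        Continuous.tendsto (by fun_prop) _
      rw [zero_mul, add_zero] at this
      exact this.mono_left nhdsWithin_le_nhds
    · filter_upwards [Ioo_mem_nhdsGT (zero_lt_one' ℝ)] with t ht using hwI t ht i
  refine le_of_tendsto hlim ?_
  filter_upwards [Ioo_mem_nhdsGT (zero_lt_one' ℝ)] with t ht using hle t ht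

/-- Moving a fixed proportion towards a positive point improves every point that has a small
coordinate. -/
theorem exists_improvement (hf : ∀ i, IsMarginal (c i) (f i) (φ i)) {C : Set (ι → ℝ)}
    (hC : Convex ℝ C) (hbox : ∀ x ∈ C, ∀ i, x i ∈ Icc 0 (c i)) {e : ι → ℝ} (heC : e ∈ C)
    (he : ∀ i, 0 < e i) :
    ∃ δ > 0, (∀ i, δ ≤ e i) ∧ ∀ x ∈ C, ∃ x' ∈ C, (∀ i, δ ≤ x' i) ∧
      ∑ i, f i (x i) ≤ ∑ i, f i (x' i) := by
  have he' : ∀ i, e i ∈ Ioc 0 (c i) := fun i => ⟨he i, (hbox e heC i).2⟩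
  -- `A` bounds the first-order loss of all coordinates together. Below `η k` the marginal of
  -- coordinate `k` is so large that a gain over a distance `e k / 2` outweighs `A`. Then `t` and
  -- `δ` are chosen so that the moved point still has its `k`-th coordinate below `η k` whenever the
  -- old one was below `δ`.
  set A : ℝ := ∑ i, φ i (e i) * c i with hA
  have hη : ∀ k, ∃ η > 0, ∀ s ∈ Ioo (0 : ℝ) η, A / (e k / 2) ≤ φ k s := by
    intro k
    obtain ⟨η, hη, h⟩ := mem_nhdsGT_iff_exists_Ioo_subset.1
      ((hf k).slope.eventually_ge_atTop (A / (e k / 2)))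
    exact ⟨η, hη, h⟩
  choose η hη0 hη using hη
  obtain ⟨t, ht0, ht1, ht⟩ : ∃ t > 0, t < 1 ∧ ∀ k, t * e k < η k / 2 := by
    have : ∀ᶠ t in 𝓝[>] (0 : ℝ), t < 1 ∧ ∀ k, t * e k < η k / 2 := by
      apply nhdsWithin_le_nhds
      refine (eventually_lt_nhds zero_lt_one).and (eventually_all.2 fun k => ?_)
      have : Tendsto (fun t : ℝ => t * e k) (𝓝 0) (𝓝 (0 * e k)) :=
        Continuous.tendsto (by fun_prop) _
      exact this.eventually (gt_mem_nhds (by rw [zero_mul]; linarith [hη0 k]))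
    obtain ⟨t, h1, h2⟩ := (this.and self_mem_nhdsWithin).exists
    exact ⟨t, h2, h1.1, h1.2⟩
  obtain ⟨δ, hδ0, hδ⟩ : ∃ δ > 0, ∀ k, δ < η k / 2 ∧ δ < e k / 2 ∧ δ < t * e k := by
    have : ∀ᶠ δ in 𝓝[>] (0 : ℝ), ∀ k, δ < η k / 2 ∧ δ < e k / 2 ∧ δ < t * e k := by
      apply nhdsWithin_le_nhds
      refine eventually_all.2 fun k => ?_
      refine (eventually_lt_nhds (by linarith [hη0 k])).and
        ((eventually_lt_nhds (by linarith [he k])).and (eventually_lt_nhds (mul_pos ht0 (he k))))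
    obtain ⟨δ, h1, h2⟩ := (this.and self_mem_nhdsWithin).exists
    exact ⟨δ, h2, h1⟩
  refine ⟨δ, hδ0, fun i => by linarith [(hδ i).2.1, he i], fun x hx => ?_⟩
  by_cases hsmall : ∀ i, δ ≤ x i
  · exact ⟨x, hx, hsmall, le_rfl⟩
  push Not at hsmall
  obtain ⟨k, hk⟩ := hsmall
  let x' : ι → ℝ := x + t • (e - x)
  have hx' : ∀ i, x' i = x i + t * (e i - x i) := fun i => rfl
  have hx'C : x' ∈ C := hC.add_smul_sub_mem hx heC ⟨ht0.le, ht1.le⟩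
  have hlow : ∀ i, t * e i ≤ x' i := fun i => by
    rw [hx']; nlinarith [(hbox x hx i).1]
  have hx'I : ∀ i, x' i ∈ Ioc 0 (c i) := fun i =>
    ⟨(mul_pos ht0 (he i)).trans_le (hlow i), (hbox x' hx'C i).2⟩
  refine ⟨x', hx'C, fun i => (hδ i).2.2.le.trans (hlow i), ?_⟩
  refine (sum_le_tangent hf hx'I (hbox x hx)).trans ?_
  rw [← coe_sum_toReal hf hx'I, EReal.coe_le_coe_iff]
  suffices h : ∑ i, φ i (x' i) * (x i - e i) ≤ 0 by
    have h3 : ∑ i, φ i (x' i) * (x i - x' i) = t * ∑ i, φ i (x' i) * (x i - e i) := by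
      rw [Finset.mul_sum]
      refine Finset.sum_congr rfl fun i _ => ?_
      rw [hx' i]; ring
    rw [h3]
    nlinarith
  -- A coordinate loses only if `x i` exceeds `e i`; then `x' i` is at least `e i` as well, and its
  -- marginal is at most that at `e i`.
  have hterm : ∀ i, φ i (x' i) * (x i - e i) ≤ φ i (e i) * c i := by
    intro i
    have hci := (hf i).pos
    have h0 : 0 ≤ φ i (e i) * c i := mul_nonneg ((hf i).nonneg _ (he' i)) hci.le
    rcases le_total (x i) (e i) with hle | hle
    · nlinarith [(hf i).nonneg _ (hx'I i)]
    · have h1 : e i ≤ x' i := by rw [hx']; nlinarith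
      have h2 := (hf i).anti (he' i) (hx'I i) h1
      have h3 : x i - e i ≤ c i := by linarith [he i, (hbox x hx i).2]
      exact mul_le_mul h2 h3 (by linarith) ((hf i).nonneg _ (he' i))
  classical
  rw [← Finset.add_sum_erase _ _ (Finset.mem_univ k)]
  have h1 : ∑ i ∈ Finset.univ.erase k, φ i (x' i) * (x i - e i) ≤ A := by
    refine (Finset.sum_le_sum fun i _ => hterm i).trans ?_
    refine Finset.sum_le_sum_of_subset_of_nonneg (Finset.erase_subset _ _) fun i _ _ => ?_
    exact mul_nonneg ((hf i).nonneg _ (he' i)) (hf i).pos.le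
  have h2 : A / (e k / 2) ≤ φ k (x' k) := by
    refine hη k _ ⟨(hx'I k).1, ?_⟩
    rw [hx']
    nlinarith [(hδ k).1, ht k, (hbox x hx k).1]
  rw [div_le_iff₀ (by linarith [he k])] at h2
  have h4 := (hf k).nonneg _ (hx'I k)
  nlinarith [(hδ k).2.1]

/-- A sum of functions with infinite marginals at `0` has a positive maximizer, which is the
only one. -/
theorem exists_strict_maximizer (hf : ∀ i, IsMarginal (c i) (f i) (φ i)) {C : Set (ι → ℝ)}
    (hC : Convex ℝ C) (hK : IsCompact C) (hbox : ∀ x ∈ C, ∀ i, x i ∈ Icc 0 (c i)) {e : ι → ℝ}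
    (heC : e ∈ C) (he : ∀ i, 0 < e i) :
    ∃ x ∈ C, (∀ i, 0 < x i) ∧ (∀ y ∈ C, ∑ i, φ i (x i) * (y i - x i) ≤ 0) ∧
      ∀ y ∈ C, y ≠ x → ∑ i, f i (y i) < ∑ i, f i (x i) := by
  obtain ⟨δ, hδ, hδe, himp⟩ := exists_improvement hf hC hbox heC he
  -- The objective is finite and continuous only away from the coordinate hyperplanes, so the
  -- extreme value theorem is applied where all coordinates are at least `δ`; the improvement step
  -- makes that maximum global.
  have hKδ : IsCompact (C ∩ {x | ∀ i, δ ≤ x i}) := by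
    refine hK.inter_right ?_
    simp only [ofPred_forall]
    exact isClosed_iInter fun i => isClosed_le continuous_const (continuous_apply i)
  have hI : ∀ x ∈ C ∩ {x | ∀ i, δ ≤ x i}, ∀ i, x i ∈ Ioc 0 (c i) := fun x hx i =>
    ⟨hδ.trans_le (hx.2 i), (hbox x hx.1 i).2⟩
  obtain ⟨x, hx, hmax⟩ := hKδ.exists_isMaxOn ⟨e, heC, hδe⟩
    (f := fun x => ∑ i, (f i (x i)).toReal)
    (continuousOn_finsetSum _ fun i _ =>
      (hf i).cont.comp (continuous_apply i).continuousOn fun x hx => hI x hx i)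
  have hopt : ∀ y ∈ C, ∑ i, f i (y i) ≤ ∑ i, f i (x i) := by
    intro y hy
    obtain ⟨y', hy'C, hy', hle⟩ := himp y hy
    refine hle.trans ?_
    rw [← coe_sum_toReal hf (hI x hx), ← coe_sum_toReal hf (hI y' ⟨hy'C, hy'⟩),
      EReal.coe_le_coe_iff]
    exact hmax ⟨hy'C, hy'⟩
  have hpos : ∀ i, 0 < x i := fun i => (hI x hx i).1
  have hfo : ∀ y ∈ C, ∑ i, φ i (x i) * (y i - x i) ≤ 0 := fun y hy =>
    firstOrder_of_optimal hf hC hbox hx.1 hpos hopt hy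
  exact ⟨x, hx.1, hpos, hfo, fun y hy hne =>
    sum_lt_of_firstOrder hf (hI x hx) (hbox y hy) hne (hfo y hy)⟩

end Optimization

/-! ### Two-by-two edge matrices. -/

theorem posSemidef_two_iff {a b d : ℝ} :
    (!![a, b; b, d] : Matrix (Fin 2) (Fin 2) ℝ).PosSemidef ↔ 0 ≤ a ∧ 0 ≤ d ∧ b ^ 2 ≤ a * d := by
  constructor
  · intro h
    have h0 := h.diag_nonneg (i := 0)
    have h1 := h.diag_nonneg (i := 1)
    have h2 := h.det_nonneg
    rw [Matrix.det_fin_two] at h2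
    simp at h0 h1 h2
    exact ⟨h0, h1, by nlinarith⟩
  · rintro ⟨h0, h1, h2⟩
    rw [Matrix.posSemidef_iff_dotProduct_mulVec]
    refine ⟨?_, fun x => ?_⟩
    · ext i j; fin_cases i <;> fin_cases j <;> simp
    · simp [Matrix.mulVec, dotProduct, Fin.sum_univ_two]
      rcases h0.eq_or_lt with h | h
      · subst h
        have hb : b = 0 := by
          have : b ^ 2 ≤ 0 := by simpa using h2
          nlinarith
        subst hb
        nlinarith [mul_nonneg h1 (sq_nonneg (x 1))]
      -- Completing the square: the product is `(a x₀ + b x₁)² + (a d - b²) x₁²`.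
      · have : 0 ≤ a * (x 0 * (a * x 0 + b * x 1) + x 1 * (b * x 0 + d * x 1)) := by
          nlinarith [sq_nonneg (a * x 0 + b * x 1), mul_nonneg (sub_nonneg.2 h2) (sq_nonneg (x 1))]
        exact nonneg_of_mul_nonneg_right this h

theorem rank_two_eq_one {a b d : ℝ} (hd : 0 < d) (h : b ^ 2 = a * d) :
    (!![a, b; b, d] : Matrix (Fin 2) (Fin 2) ℝ).rank = 1 := by
  have e : (!![a, b; b, d] : Matrix (Fin 2) (Fin 2) ℝ) = Matrix.vecMulVec ![b, d] ![b / d, 1] := by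
    have ha : a = b * (b / d) := by field_simp; linarith
    have hb : b = d * (b / d) := by field_simp
    ext i j
    fin_cases i <;> fin_cases j <;> simp [Matrix.vecMulVec_apply, ← ha, ← hb]
  refine le_antisymm (e ▸ Matrix.rank_vecMulVec_le _ _) ?_
  rw [Nat.one_le_iff_ne_zero, Ne, Matrix.rank, Submodule.finrank_eq_zero, LinearMap.range_eq_bot]
  intro h0
  have := congrFun (LinearMap.congr_fun h0 ![0, 1]) 1
  simp at this
  exact hd.ne' this

/-! ### Power flow on the tree, in terms of loads and squared currents. -/

namespace Network

variable {N T : Type*}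

/-- Squared impedance of an edge. -/
def impSq (𝒩 : Network N T) (k : N) : ℝ := 𝒩.R k ^ 2 + 𝒩.X k ^ 2

/-- Squared current on an edge. -/
def current (𝒩 : Network N T) (W : WVar N) (k : N) : ℝ :=
  (W.diag (𝒩.parent k) - 2 * W.off k + W.diag (some k)) / 𝒩.impSq k

theorem Standing.impSq_pos {𝒩 : Network N T} (h : 𝒩.Standing) (k : N) : 0 < 𝒩.impSq k := by
  unfold impSq
  rcases h.impedance k with hk | hk
  · have := sq_pos_of_ne_zero hk; positivity
  · have := sq_pos_of_ne_zero hk; positivity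

theorem Standing.diag_parent {𝒩 : Network N T} (h : 𝒩.Standing) (W : WVar N) (k : N) :
    W.diag (𝒩.parent k)
      = 2 * W.off k - W.diag (some k) + 𝒩.impSq k * 𝒩.current W k := by
  rw [current, mul_div_cancel₀ _ (h.impSq_pos k).ne']
  ring

/-- A function on the nodes with prescribed value at the feeder and prescribed drops along the
edges. -/
theorem Standing.exists_potential {𝒩 : Network N T} (h : 𝒩.Standing) (v₀ : ℝ)
    (drop : N → ℝ) :
    ∃ v : Option N → ℝ, v none = v₀ ∧ ∀ k, v (some k) = v (𝒩.parent k) - drop k := by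
  let step : (k : N) → ((l : N) → 𝒩.parent k = some l → ℝ) → ℝ := fun k rec =>
    (match hp : 𝒩.parent k with
      | none => v₀
      | some l => rec l hp) - drop k
  let w : N → ℝ := h.tree.fix step
  refine ⟨fun o => o.elim v₀ w, rfl, fun k => ?_⟩
  change w k = _
  have : w k = step k (fun l _ => w l) := h.tree.fix_eq step k
  rw [this]
  simp only [step]
  split <;> simp_all

theorem Standing.node_induction {𝒩 : Network N T} (h : 𝒩.Standing) {P : Option N → Prop}
    (h0 : P none) (hs : ∀ k, P (𝒩.parent k) → P (some k)) : ∀ o, P o := by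
  have : ∀ k : N, P (some k) := fun k => by
    induction k using h.tree.induction with
    | _ k ih =>
      apply hs
      match hp : 𝒩.parent k with
      | none => exact h0
      | some l => exact ih l hp
  rintro (_ | k)
  exacts [h0, this k]

section Finite

variable [Fintype N] [Fintype T]

/-- `P R + Q X` at an edge, in terms of the loads and of the squared currents. -/
def transfer (𝒩 : Network N T) (Λ : N → T → ℝ) (L : N → ℝ) (k : N) : ℝ :=
  (∑ l ∈ 𝒩.subtree k, ∑ j, Λ l j + ∑ l ∈ 𝒩.subtree k, ∑ s ∈ 𝒩.children l, L s * 𝒩.R s) * 𝒩.R k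
    + (∑ l ∈ 𝒩.subtree k, ∑ s ∈ 𝒩.children l, L s * 𝒩.X s) * 𝒩.X k

/-- With squared currents as variables, the losses are linear, so Kirchhoff's law involves only
`transfer`, which is linear and, by nonnegativity of `R` and `X`, monotone in loads and currents. -/
theorem transfer_current (𝒩 : Network N T) (Λ : N → T → ℝ) (W : WVar N) (k : N) :
    𝒩.transfer Λ (𝒩.current W) k = 𝒩.powerP Λ W k * 𝒩.R k + 𝒩.powerQ W k * 𝒩.X k := by
  simp only [transfer, powerP, powerQ, lossP, lossQ, current, impSq, div_mul_eq_mul_div]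

theorem Standing.transfer_mono {𝒩 : Network N T} (h : 𝒩.Standing) {Λ Λ' : N → T → ℝ}
    {L L' : N → ℝ} (hΛ : ∀ i j, Λ i j ≤ Λ' i j) (hL : ∀ k, L k ≤ L' k) (k : N) :
    𝒩.transfer Λ L k ≤ 𝒩.transfer Λ' L' k := by
  unfold transfer
  have hR := h.R_nonneg
  have hX := h.X_nonneg
  have := hR k
  have := hX k
  gcongr with l _ j _ l _ s _ l _ s _
  exacts [hΛ l j, hR s, hL s, hX s, hL s]

theorem transfer_zero (𝒩 : Network N T) (k : N) : 𝒩.transfer (fun _ _ => 0) (fun _ => 0) k = 0 := by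
  simp [transfer]

theorem Standing.transfer_nonneg {𝒩 : Network N T} (h : 𝒩.Standing) {Λ : N → T → ℝ}
    {L : N → ℝ} (hΛ : ∀ i j, 0 ≤ Λ i j) (hL : ∀ k, 0 ≤ L k) (k : N) : 0 ≤ 𝒩.transfer Λ L k := by
  rw [← 𝒩.transfer_zero k]
  exact h.transfer_mono hΛ hL k

theorem transfer_smul (𝒩 : Network N T) (Λ : N → T → ℝ) (L : N → ℝ) (a : ℝ) (k : N) :
    𝒩.transfer (fun i j => a * Λ i j) (fun k => a * L k) k = a * 𝒩.transfer Λ L k := by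
  simp only [transfer, mul_assoc, ← Finset.mul_sum]
  ring

/-- The power-flow equations determine the voltages from the loads and the squared currents. -/
theorem Standing.exists_flow {𝒩 : Network N T} (h : 𝒩.Standing) (Λ : N → T → ℝ) (L : N → ℝ) :
    ∃ W : WVar N, W.diag none = 𝒩.V₀ ^ 2 ∧ 𝒩.current W = L ∧
      (∀ k, W.off k = W.diag (some k) + 𝒩.transfer Λ L k) ∧
      ∀ k, W.diag (some k)
        = W.diag (𝒩.parent k) - (2 * 𝒩.transfer Λ L k + 𝒩.impSq k * L k) := by
  obtain ⟨v, hv0, hv⟩ := h.exists_potential (𝒩.V₀ ^ 2)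
    (fun k => 2 * 𝒩.transfer Λ L k + 𝒩.impSq k * L k)
  refine ⟨⟨v, fun k => v (some k) + 𝒩.transfer Λ L k⟩, hv0, ?_, fun k => rfl, hv⟩
  ext k
  simp only [current]
  rw [div_eq_iff (h.impSq_pos k).ne']
  linarith [hv k]

theorem kirchhoff_iff (𝒩 : Network N T) (Λ : N → T → ℝ) (W : WVar N) (k : N) :
    W.off k - W.diag (some k) - 𝒩.powerP Λ W k * 𝒩.R k - 𝒩.powerQ W k * 𝒩.X k = 0 ↔
      W.off k = W.diag (some k) + 𝒩.transfer Λ (𝒩.current W) k := by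
  rw [transfer_current]
  constructor <;> intro h <;> linarith

section Feasible

variable {𝒩 : Network N T} {Λ : N → T → ℝ} {W : WVar N}

theorem VoltageFeasible.off_eq (hW : 𝒩.VoltageFeasible Λ W) (k : N) :
    W.off k = W.diag (some k) + 𝒩.transfer Λ (𝒩.current W) k :=
  (𝒩.kirchhoff_iff Λ W k).1 (hW.kirchhoff k)

theorem VoltageFeasible.diag_pos (h : 𝒩.Standing) (hW : 𝒩.VoltageFeasible Λ W) (k : N) :
    0 < W.diag (some k) := (h.vlo_pos k).trans_le (hW.lower k)

/-- Kirchhoff's law gives `W_pk = W_kk + s` and `W_pp = W_kk + 2 s + |Z|² L`, where `s` is the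
transfer, `L` the squared current and `|Z|²` the squared impedance. The determinant condition then
reduces to this inequality, and equality means a singular edge matrix. -/
theorem VoltageFeasible.sq_le (h : 𝒩.Standing) (hW : 𝒩.VoltageFeasible Λ W) (k : N) :
    𝒩.transfer Λ (𝒩.current W) k ^ 2 ≤ 𝒩.impSq k * 𝒩.current W k * W.diag (some k) := by
  have h1 := (posSemidef_two_iff.1 (hW.psd k)).2.2
  rw [h.diag_parent W k, hW.off_eq k] at h1
  nlinarith

theorem VoltageFeasible.current_nonneg (h : 𝒩.Standing) (hW : 𝒩.VoltageFeasible Λ W) (k : N) :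
    0 ≤ 𝒩.current W k := by
  have h1 : 0 ≤ (𝒩.impSq k * W.diag (some k)) * 𝒩.current W k := by
    have := (sq_nonneg _).trans (hW.sq_le h k)
    linarith
  exact nonneg_of_mul_nonneg_right h1 (mul_pos (h.impSq_pos k) (hW.diag_pos h k))

/-- Sufficient conditions for feasibility of a flow. -/
theorem Standing.feasible_of_flow (h : 𝒩.Standing) {L : N → ℝ} (hΛ : ∀ i j, 0 ≤ Λ i j)
    (hL : ∀ k, 0 ≤ L k) (h0 : W.diag none = 𝒩.V₀ ^ 2) (hc : 𝒩.current W = L)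
    (hoff : ∀ k, W.off k = W.diag (some k) + 𝒩.transfer Λ L k)
    (hlow : ∀ k, 𝒩.vlo k ≤ W.diag (some k))
    (hsq : ∀ k, 𝒩.transfer Λ L k ^ 2 ≤ 𝒩.impSq k * L k * W.diag (some k)) :
    𝒩.VoltageFeasible Λ W := by
  subst hc
  -- Voltages fall away from the feeder, so the upper limits hold automatically, being at least `V₀
  -- ^ 2`.
  have hdec : ∀ k, W.diag (some k) ≤ W.diag (𝒩.parent k) := fun k => by
    rw [h.diag_parent W k, hoff k]
    have := h.transfer_nonneg hΛ hL k
    have := mul_nonneg (h.impSq_pos k).le (hL k)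
    linarith
  have hpos : ∀ k, 0 < W.diag (some k) := fun k => (h.vlo_pos k).trans_le (hlow k)
  have hup : ∀ o, W.diag o ≤ 𝒩.V₀ ^ 2 :=
    h.node_induction h0.le fun k hk => (hdec k).trans hk
  refine ⟨h0, fun k => (𝒩.kirchhoff_iff Λ W k).2 (hoff k), hlow,
    fun k => (hup _).trans (h.le_vhi k), fun k => ?_⟩
  refine posSemidef_two_iff.2 ⟨(hpos k).le.trans (hdec k), (hpos k).le, ?_⟩
  rw [h.diag_parent W k, hoff k]
  nlinarith [hsq k]

/-- Replacing each squared current by the least one compatible with the present flow yields a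
feasible flow with smaller currents. -/
theorem VoltageFeasible.exists_reduced (h : 𝒩.Standing) (hΛ : ∀ i j, 0 ≤ Λ i j)
    (hW : 𝒩.VoltageFeasible Λ W) :
    ∃ W', 𝒩.VoltageFeasible Λ W' ∧ ∀ k, 𝒩.current W' k
      = 𝒩.transfer Λ (𝒩.current W) k ^ 2 / (𝒩.impSq k * W.diag (some k)) := by
  set L := 𝒩.current W with hLdef
  set L' : N → ℝ := fun k => 𝒩.transfer Λ L k ^ 2 / (𝒩.impSq k * W.diag (some k)) with hL'
  have hden : ∀ k, 0 < 𝒩.impSq k * W.diag (some k) := fun k =>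
    mul_pos (h.impSq_pos k) (hW.diag_pos h k)
  have hL0 : ∀ k, 0 ≤ L k := fun k => hW.current_nonneg h k
  have hL'0 : ∀ k, 0 ≤ L' k := fun k => div_nonneg (sq_nonneg _) (hden k).le
  have hle : ∀ k, L' k ≤ L k := fun k => by
    rw [hL', div_le_iff₀ (hden k)]
    linarith [hW.sq_le h k]
  obtain ⟨W', h0, hc, hoff, hdiag⟩ := h.exists_flow Λ L'
  have htr : ∀ k, 𝒩.transfer Λ L' k ≤ 𝒩.transfer Λ L k := h.transfer_mono (fun _ _ => le_rfl) hle
  -- Smaller currents cause smaller drops along every edge, so all voltages rise; this preserves the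
  -- lower limits.
  have hv : ∀ o, W.diag o ≤ W'.diag o := by
    refine h.node_induction (by rw [h0, hW.feeder]) fun k hk => ?_
    have h1 := h.diag_parent W k
    rw [hW.off_eq k, ← hLdef] at h1
    have h2 := mul_le_mul_of_nonneg_left (hle k) (h.impSq_pos k).le
    rw [hdiag k]
    linarith [htr k]
  refine ⟨W', ?_, fun k => congrFun hc k⟩
  refine h.feasible_of_flow hΛ hL'0 h0 hc hoff (fun k => (hW.lower k).trans (hv _)) fun k => ?_
  have h1 : 𝒩.transfer Λ L' k ^ 2 ≤ 𝒩.transfer Λ L k ^ 2 :=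
    pow_le_pow_left₀ (h.transfer_nonneg hΛ hL'0 k) (htr k) 2
  -- `L'` makes the old transfers and old voltages satisfy the determinant condition with equality.
  -- Replacing them by the smaller new transfers and larger new voltages only relaxes it.
  have h2 : 𝒩.transfer Λ L k ^ 2 = 𝒩.impSq k * L' k * W.diag (some k) := by
    have : L' k * (𝒩.impSq k * W.diag (some k)) = 𝒩.transfer Λ L k ^ 2 :=
      div_mul_cancel₀ _ (hden k).ne'
    linarith
  have h3 := mul_le_mul_of_nonneg_left (hv (some k)) (mul_nonneg (h.impSq_pos k).le (hL'0 k))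
  linarith

end Feasible

/-! ### The set of feasible loads -/

/-- Nonnegative loads that respect the load limits and the relaxed voltage constraints. -/
def loadSet (𝒩 : Network N T) : Set (N → T → ℝ) :=
  {Λ | (∀ i j, 0 ≤ Λ i j) ∧ (∀ i, ∑ j, Λ i j ≤ 𝒩.M i) ∧ ∃ W, 𝒩.VoltageFeasible Λ W}

/-- Loads together with the voltage variables. -/
def flowSet (𝒩 : Network N T) : Set ((N → T → ℝ) × (Option N → ℝ) × (N → ℝ)) :=
  {x | (∀ i j, 0 ≤ x.1 i j) ∧ (∀ i, ∑ j, x.1 i j ≤ 𝒩.M i) ∧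
    𝒩.VoltageFeasible x.1 ⟨x.2.1, x.2.2⟩}

theorem voltageFeasible_iff (𝒩 : Network N T) (Λ : N → T → ℝ) (W : WVar N) :
    𝒩.VoltageFeasible Λ W ↔ W.diag none = 𝒩.V₀ ^ 2 ∧
      (∀ k, W.off k = W.diag (some k) + 𝒩.transfer Λ (𝒩.current W) k) ∧
      (∀ k, 𝒩.vlo k ≤ W.diag (some k)) ∧ (∀ k, W.diag (some k) ≤ 𝒩.vhi k) ∧
      ∀ k, 0 ≤ W.diag (𝒩.parent k) ∧ 0 ≤ W.diag (some k) ∧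
        W.off k ^ 2 ≤ W.diag (𝒩.parent k) * W.diag (some k) :=
  ⟨fun h => ⟨h.feeder, h.off_eq, h.lower, h.upper, fun k => posSemidef_two_iff.1 (h.psd k)⟩,
    fun h => ⟨h.1, fun k => (𝒩.kirchhoff_iff Λ W k).2 (h.2.1 k), h.2.2.1, h.2.2.2.1,
      fun k => posSemidef_two_iff.2 (h.2.2.2.2 k)⟩⟩

theorem isClosed_flowSet (𝒩 : Network N T) : IsClosed 𝒩.flowSet := by
  have e : 𝒩.flowSet = {x | (∀ i j, 0 ≤ x.1 i j) ∧ (∀ i, ∑ j, x.1 i j ≤ 𝒩.M i) ∧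
      x.2.1 none = 𝒩.V₀ ^ 2 ∧
      (∀ k, x.2.2 k = x.2.1 (some k) + 𝒩.transfer x.1 (𝒩.current ⟨x.2.1, x.2.2⟩) k) ∧
      (∀ k, 𝒩.vlo k ≤ x.2.1 (some k)) ∧ (∀ k, x.2.1 (some k) ≤ 𝒩.vhi k) ∧
      ∀ k, 0 ≤ x.2.1 (𝒩.parent k) ∧ 0 ≤ x.2.1 (some k) ∧
        x.2.2 k ^ 2 ≤ x.2.1 (𝒩.parent k) * x.2.1 (some k)} := by
    ext x
    simp only [flowSet, voltageFeasible_iff, mem_ofPred_eq]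
  rw [e]
  simp only [ofPred_and, ofPred_forall]
  have hcl : ∀ {f g : ((N → T → ℝ) × (Option N → ℝ) × (N → ℝ)) → ℝ}, Continuous f →
      Continuous g → IsClosed {x | f x ≤ g x} := fun hf hg => isClosed_le hf hg
  refine IsClosed.inter (isClosed_iInter fun i => isClosed_iInter fun j => hcl ?_ ?_) <|
    IsClosed.inter (isClosed_iInter fun i => hcl ?_ ?_) <|
    IsClosed.inter (isClosed_eq ?_ ?_) <|
    IsClosed.inter (isClosed_iInter fun i => isClosed_eq ?_ ?_) <|
    IsClosed.inter (isClosed_iInter fun i => hcl ?_ ?_) <|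
    IsClosed.inter (isClosed_iInter fun i => hcl ?_ ?_) <|
    isClosed_iInter fun i => IsClosed.inter (hcl ?_ ?_) <| IsClosed.inter (hcl ?_ ?_) (hcl ?_ ?_)
  all_goals (try unfold transfer current); fun_prop

/-- The diagonal entries are bounded by the voltage limits, the off-diagonal ones then by positive
semidefiniteness, and the loads by `M`; `b` is a crude bound common to all voltage variables. -/
theorem Standing.isCompact_flowSet {𝒩 : Network N T} (h : 𝒩.Standing) :
    IsCompact 𝒩.flowSet := by
  set b : ℝ := 𝒩.V₀ ^ 2 + ∑ k, 𝒩.vhi k with hb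
  have hvhi : ∀ k, 0 ≤ 𝒩.vhi k := fun k => (sq_nonneg _).trans (h.le_vhi k)
  have hbox : IsCompact ((Icc (0 : N → T → ℝ) (fun i _ => 𝒩.M i)) ×ˢ
      ((Icc (0 : Option N → ℝ) (fun _ => b)) ×ˢ (Icc (fun _ : N => -b) (fun _ => b)))) :=
    isCompact_Icc.prod (isCompact_Icc.prod isCompact_Icc)
  refine hbox.of_isClosed_subset 𝒩.isClosed_flowSet ?_
  rintro ⟨Λ, d, o⟩ ⟨h0, hM, hW⟩
  have hd0 : ∀ x, 0 ≤ d x := by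
    rintro (_ | k)
    · exact (sq_nonneg _).trans_eq hW.feeder.symm
    · exact (hW.diag_pos h k).le
  have hdb : ∀ x, d x ≤ b := by
    have hsum : 0 ≤ ∑ k, 𝒩.vhi k := Finset.sum_nonneg fun k _ => hvhi k
    rintro (_ | k)
    · exact hW.feeder.le.trans (by linarith)
    · have h1 := Finset.single_le_sum (fun k _ => hvhi k) (Finset.mem_univ k)
      have := hW.upper k
      simp only at this
      nlinarith [sq_nonneg 𝒩.V₀]
  have hob : ∀ k, |o k| ≤ b := fun k => by
    have h1 := (posSemidef_two_iff.1 (hW.psd k)).2.2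
    simp only at h1
    have hb0 : 0 ≤ b := (hd0 none).trans (hdb none)
    refine abs_le_of_sq_le_sq (h1.trans ?_) hb0
    nlinarith [hd0 (𝒩.parent k), hdb (𝒩.parent k), hd0 (some k), hdb (some k)]
  refine ⟨⟨fun i j => h0 i j, fun i j => ?_⟩, ⟨hd0, hdb⟩, fun k => (abs_le.1 (hob k)).1,
    fun k => (abs_le.1 (hob k)).2⟩
  exact (Finset.single_le_sum (fun j _ => h0 i j) (Finset.mem_univ j)).trans (hM i)

theorem Standing.isCompact_loadSet {𝒩 : Network N T} (h : 𝒩.Standing) :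
    IsCompact 𝒩.loadSet := by
  have e : 𝒩.loadSet = Prod.fst '' 𝒩.flowSet := by
    ext Λ
    constructor
    · rintro ⟨h0, hM, W, hW⟩
      exact ⟨(Λ, W.diag, W.off), ⟨h0, hM, hW⟩, rfl⟩
    · rintro ⟨x, ⟨h0, hM, hW⟩, rfl⟩
      exact ⟨h0, hM, _, hW⟩
  rw [e]
  exact h.isCompact_flowSet.image continuous_fst

/-- The relaxation of the rank condition is exact: every feasible load is served by a flow with
rank-one edge matrices. -/
theorem Standing.exists_rank_one {𝒩 : Network N T} (h : 𝒩.Standing) {Λ : N → T → ℝ}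
    (hΛ : Λ ∈ 𝒩.loadSet) :
    ∃ W, 𝒩.VoltageFeasible Λ W ∧ ∀ k, (𝒩.edgeMatrix W k).rank = 1 := by
  obtain ⟨h0, hM, W₀, hW₀⟩ := hΛ
  -- Take a flow of least total squared current among those serving `Λ`. Reducing it as in
  -- `exists_reduced` lowers no current strictly, so every current already has its least value,
  -- which forces determinant zero on each edge.
  have hK : IsCompact (𝒩.flowSet ∩ Prod.fst ⁻¹' {Λ}) :=
    h.isCompact_flowSet.inter_right (isClosed_singleton.preimage continuous_fst)
  obtain ⟨⟨Λ', d, o⟩, ⟨⟨_, _, hW⟩, hΛ'⟩, hmin⟩ := hK.exists_isMinOn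
    ⟨(Λ, W₀.diag, W₀.off), ⟨h0, hM, hW₀⟩, rfl⟩
    (f := fun x => ∑ k, 𝒩.current ⟨x.2.1, x.2.2⟩ k)
    (by unfold current; fun_prop)
  obtain rfl : Λ' = Λ := hΛ'
  refine ⟨_, hW, fun k => rank_two_eq_one (hW.diag_pos h k) ?_⟩
  obtain ⟨W', hW', hc⟩ := hW.exists_reduced h h0
  have hden : ∀ k, 0 < 𝒩.impSq k * d (some k) := fun k =>
    mul_pos (h.impSq_pos k) (hW.diag_pos h k)
  have hle : ∀ k, 𝒩.current W' k ≤ 𝒩.current ⟨d, o⟩ k := fun k => by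
    rw [hc k, div_le_iff₀ (hden k)]
    linarith [hW.sq_le h k]
  have hmin' : ∑ k, 𝒩.current ⟨d, o⟩ k ≤ ∑ k, 𝒩.current W' k :=
    hmin (show (Λ', W'.diag, W'.off) ∈ _ from ⟨⟨h0, hM, hW'⟩, rfl⟩)
  have heq : 𝒩.current W' k = 𝒩.current ⟨d, o⟩ k :=
    (Finset.sum_eq_sum_iff_of_le fun k _ => hle k).1
      (le_antisymm (Finset.sum_le_sum fun k _ => hle k) hmin') k (Finset.mem_univ k)
  rw [hc k, div_eq_iff (hden k).ne'] at heq
  rw [h.diag_parent ⟨d, o⟩ k, hW.off_eq k]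
  simp only at heq ⊢
  linarith

/-- Given the loads and voltage variables jointly, all constraints are linear except
semidefiniteness, which defines a convex cone. The rank condition would destroy this. -/
theorem convex_loadSet (𝒩 : Network N T) : Convex ℝ 𝒩.loadSet := by
  rintro Λ ⟨h0, hM, W, hW⟩ Λ' ⟨h0', hM', W', hW'⟩ a b ha hb hab
  have hΛ : ∀ i j, (a • Λ + b • Λ') i j = a * Λ i j + b * Λ' i j := fun i j => rfl
  refine ⟨fun i j => ?_, fun i => ?_, ⟨fun o => a * W.diag o + b * W'.diag o,
    fun k => a * W.off k + b * W'.off k⟩, ?_⟩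
  · rw [hΛ]
    exact add_nonneg (mul_nonneg ha (h0 i j)) (mul_nonneg hb (h0' i j))
  · simp only [hΛ, Finset.sum_add_distrib, ← Finset.mul_sum]
    have := mul_le_mul_of_nonneg_left (hM i) ha
    have := mul_le_mul_of_nonneg_left (hM' i) hb
    have : 𝒩.M i = a * 𝒩.M i + b * 𝒩.M i := by rw [← add_mul, hab, one_mul]
    linarith
  have hconv : ∀ x y m : ℝ, x ≤ m → y ≤ m → a * x + b * y ≤ m := fun x y m hx hy => by
    have := mul_le_mul_of_nonneg_left hx ha
    have := mul_le_mul_of_nonneg_left hy hb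
    have : m = a * m + b * m := by rw [← add_mul, hab, one_mul]
    linarith
  refine ⟨?_, fun k => ?_, fun k => ?_, fun k => ?_, fun k => ?_⟩
  · simp only [hW.feeder, hW'.feeder, ← add_mul, hab, one_mul]
  · rw [kirchhoff_iff]
    simp only [hW.off_eq k, hW'.off_eq k]
    have hcur : 𝒩.current ⟨fun o => a * W.diag o + b * W'.diag o,
        fun k => a * W.off k + b * W'.off k⟩
        = fun k => a * 𝒩.current W k + b * 𝒩.current W' k := by
      ext k
      simp only [current]
      ring
    rw [hcur]
    simp only [transfer, hΛ, add_mul, Finset.sum_add_distrib, mul_assoc, ← Finset.mul_sum]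
    ring
  · have := hconv (-W.diag (some k)) (-W'.diag (some k)) (-𝒩.vlo k) (by linarith [hW.lower k])
      (by linarith [hW'.lower k])
    simp only
    linarith
  · exact hconv _ _ _ (hW.upper k) (hW'.upper k)
  · have := ((hW.psd k).smul ha).add ((hW'.psd k).smul hb)
    convert this using 1
    ext i j
    fin_cases i <;> fin_cases j <;> simp [edgeMatrix]

/-- Small multiples of any load are feasible. -/
theorem Standing.eventually_mem_loadSet {𝒩 : Network N T} (h : 𝒩.Standing) {Λ : N → T → ℝ}
    (hΛ : ∀ i j, 0 ≤ Λ i j) : ∀ᶠ ε in 𝓝[>] (0 : ℝ), (fun i j => ε * Λ i j) ∈ 𝒩.loadSet := by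
  -- Unit currents are an arbitrary positive choice. When loads and currents are scaled by `ε`, the
  -- squared transfer is of order `ε²`, while the bound it must respect is of order `ε`.
  obtain ⟨W, hW0, hWc, hWoff, -⟩ := h.exists_flow Λ (fun _ => 1)
  set s := 𝒩.transfer Λ (fun _ => 1) with hs
  have hev : ∀ᶠ ε in 𝓝 (0 : ℝ), (∀ i : N, ∑ j, ε * Λ i j < 𝒩.M i) ∧
      (∀ k, 𝒩.vlo k < 𝒩.V₀ ^ 2 + ε * (W.diag (some k) - 𝒩.V₀ ^ 2)) ∧
      ∀ k, ε * s k ^ 2 < 𝒩.impSq k * 𝒩.vlo k := by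
    refine (eventually_all.2 fun i => ?_).and
      ((eventually_all.2 fun k => ?_).and (eventually_all.2 fun k => ?_))
    · have : Tendsto (fun ε : ℝ => ∑ j, ε * Λ i j) (𝓝 0) (𝓝 (∑ j, 0 * Λ i j)) :=
        Continuous.tendsto (by fun_prop) _
      exact this.eventually (gt_mem_nhds (by simpa using h.M_pos i))
    · have : Tendsto (fun ε : ℝ => 𝒩.V₀ ^ 2 + ε * (W.diag (some k) - 𝒩.V₀ ^ 2)) (𝓝 0)
        (𝓝 (𝒩.V₀ ^ 2 + 0 * (W.diag (some k) - 𝒩.V₀ ^ 2))) := Continuous.tendsto (by fun_prop) _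
      exact this.eventually (lt_mem_nhds (by simpa using h.vlo_lt k))
    · have : Tendsto (fun ε : ℝ => ε * s k ^ 2) (𝓝 0) (𝓝 (0 * s k ^ 2)) :=
        Continuous.tendsto (by fun_prop) _
      exact this.eventually (gt_mem_nhds (by
        simpa using mul_pos (h.impSq_pos k) (h.vlo_pos k)))
  filter_upwards [hev.filter_mono nhdsWithin_le_nhds, self_mem_nhdsWithin] with ε hε' hε
  obtain ⟨hM, hlow, hsq⟩ := hε'
  have hε0 : 0 < ε := hε
  have htr : ∀ k, 𝒩.transfer (fun i j => ε * Λ i j) (fun _ => ε) k = ε * s k := fun k => by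
    simpa using 𝒩.transfer_smul Λ (fun _ => 1) ε k
  -- The voltages interpolate between the no-load state, where every entry is `V₀ ^ 2`, and the flow
  -- `W`; by linearity the currents of the interpolation are `ε`.
  refine ⟨fun i j => mul_nonneg hε0.le (hΛ i j), fun i => (hM i).le,
    ⟨fun o => 𝒩.V₀ ^ 2 + ε * (W.diag o - 𝒩.V₀ ^ 2),
      fun k => 𝒩.V₀ ^ 2 + ε * (W.off k - 𝒩.V₀ ^ 2)⟩, ?_⟩
  refine h.feasible_of_flow (L := fun _ => ε) (fun i j => mul_nonneg hε0.le (hΛ i j))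
    (fun _ => hε0.le) ?_ ?_ ?_ (fun k => (hlow k).le) ?_
  · simp [hW0]
  · ext k
    have := congrFun hWc k
    simp only [current] at this ⊢
    rw [div_eq_iff (h.impSq_pos k).ne'] at this ⊢
    linear_combination ε * this
  · intro k
    simp only
    rw [htr, hWoff k]
    ring
  · intro k
    rw [htr]
    have h1 := mul_le_mul_of_nonneg_left (hlow k).le (h.impSq_pos k).le
    have h2 := mul_le_mul_of_nonneg_left ((hsq k).le.trans h1) hε0.le
    simp only
    nlinarith

end Finite
end Network

/-! ### Marginal utilities. -/

theorem IsUtility.coe {u : ℝ → EReal} (hu : IsUtility u) {x : ℝ} (hx : 0 < x) :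
    ((u x).toReal : EReal) = u x :=
  EReal.coe_toReal (hu.finite x hx).2 (hu.finite x hx).1

theorem IsUtility.strictConcaveOn {u : ℝ → EReal} (hu : IsUtility u) :
    StrictConcaveOn ℝ (Ioi 0) (fun x => (u x).toReal) := by
  refine ⟨convex_Ioi 0, fun x hx y hy hne a b ha hb hab => ?_⟩
  have h := hu.strictConcave x (mem_Ici.2 (le_of_lt hx)) y (mem_Ici.2 (le_of_lt hy)) hne
    a b ha hb hab
  have hm : 0 < a * x + b * y := add_pos (mul_pos ha hx) (mul_pos hb hy)
  rw [← hu.coe hx, ← hu.coe hy, ← hu.coe hm, ← EReal.coe_mul, ← EReal.coe_mul, ← EReal.coe_add,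
    EReal.coe_lt_coe_iff] at h
  exact h

theorem IsUtility.strictAntiOn_derivE {u : ℝ → EReal} (hu : IsUtility u) :
    StrictAntiOn (derivE u) (Ioi 0) :=
  hu.strictConcaveOn.strictAntiOn_deriv fun x hx => hu.diff x hx

/-- By strict concavity the derivative exceeds the slope of the chord to `x + 1`, which is positive
by monotonicity; strict monotonicity alone would give only `0 ≤`. -/
theorem IsUtility.derivE_pos {u : ℝ → EReal} (hu : IsUtility u) {x : ℝ} (hx : 0 < x) :
    0 < derivE u x := by
  have hx1 : 0 < x + 1 := by linarith
  have h := hu.strictConcaveOn.slope_lt_deriv (x := x) (y := x + 1) hx hx1 (by linarith)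
    (hu.diff x hx)
  refine lt_trans ?_ h
  rw [slope_def_field]
  refine div_pos (sub_pos.2 ?_) (by linarith)
  rw [← EReal.coe_lt_coe_iff, hu.coe hx, hu.coe hx1]
  exact hu.strictMono (mem_Ici.2 hx.le) (mem_Ici.2 hx1.le) (by linarith)

theorem IsUtility.continuousOn_derivE {u : ℝ → EReal} (hu : IsUtility u) :
    ContinuousOn (derivE u) (Ioi 0) :=
  fun x hx => (hu.diff₂ x hx).continuousAt.continuousWithinAt

theorem IsUtility.isMarginal {u : ℝ → EReal} (hu : IsUtility u) {c : ℝ} (hc : 0 < c) :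
    IsMarginal c u (derivE u) := by
  have hsub : Ioc 0 c ⊆ Ioi 0 := fun x hx => hx.1
  refine IsMarginal.of_hasDerivAt hc (fun x hx => hu.finite x hx.1) (fun x hx => ?_) ?_
    (fun x hx => (hu.diff x hx.1).hasDerivAt) (hu.strictAntiOn_derivE.mono hsub)
    (hu.continuousOn_derivE.mono hsub) (fun x hx => (hu.derivE_pos hx.1).le) hu.slope
  · exact (hu.strictMono self_mem_Ici (mem_Ici.2 hx.1.le) hx.1).le
  · exact fun x hx => (hu.diff x hx.1).continuousAt.continuousWithinAt

/-! ### Existence and characterization of the charging rates. -/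

namespace Network

variable {N T : Type*} [Fintype N] [Fintype T]

/-- The charging rates that are feasible in state `z`. -/
def rateSet (𝒩 : Network N T) (z : N → T → ℝ) : Set (N × T → ℝ) :=
  {p | (∀ x, p x ∈ Icc 0 (𝒩.cmax x.2)) ∧ (fun i j => z i j * p (i, j)) ∈ 𝒩.loadSet}

/-- Exactness of the relaxation, `exists_rank_one`, disposes of the rank condition here, and the
charging problem becomes convex. -/
theorem Standing.rateFeasible_iff {𝒩 : Network N T} (h : 𝒩.Standing) {z : N → T → ℝ}
    (hz : ∀ i j, 0 ≤ z i j) (p : N → T → ℝ) :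
    𝒩.RateFeasible z p ↔ (fun x => p x.1 x.2) ∈ 𝒩.rateSet z := by
  constructor
  · intro hp
    obtain ⟨W, hW, -⟩ := hp.voltage
    exact ⟨fun x => ⟨hp.nonneg _ _, hp.le_cmax _ _⟩,
      fun i j => mul_nonneg (hz i j) (hp.nonneg i j), hp.load, W, hW⟩
  · rintro ⟨hbox, hload⟩
    exact ⟨hload.2.1, fun i j => (hbox (i, j)).1, fun i j => (hbox (i, j)).2,
      h.exists_rank_one hload⟩

theorem convex_rateSet (𝒩 : Network N T) (z : N → T → ℝ) : Convex ℝ (𝒩.rateSet z) := by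
  rintro p ⟨hp, hpl⟩ p' ⟨hp', hpl'⟩ a b ha hb hab
  refine ⟨fun x => convex_Icc _ _ (hp x) (hp' x) ha hb hab, ?_⟩
  convert 𝒩.convex_loadSet hpl hpl' ha hb hab using 1
  ext i j
  simp only [Pi.add_apply, Pi.smul_apply, smul_eq_mul]
  ring

theorem Standing.isCompact_rateSet {𝒩 : Network N T} (h : 𝒩.Standing) (z : N → T → ℝ) :
    IsCompact (𝒩.rateSet z) := by
  have hbox : IsCompact (Icc (0 : N × T → ℝ) (fun x => 𝒩.cmax x.2)) := isCompact_Icc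
  have hcont : Continuous fun (p : N × T → ℝ) => fun i j => z i j * p (i, j) := by fun_prop
  convert hbox.inter_right (h.isCompact_loadSet.isClosed.preimage hcont) using 1
  ext p
  exact and_congr_left fun _ => ⟨fun hp => ⟨fun x => (hp x).1, fun x => (hp x).2⟩,
    fun hp x => ⟨hp.1 x, hp.2 x⟩⟩

theorem Standing.exists_pos_mem_rateSet {𝒩 : Network N T} (h : 𝒩.Standing) {z : N → T → ℝ}
    (hz : ∀ i j, 0 ≤ z i j) : ∃ p ∈ 𝒩.rateSet z, ∀ x, 0 < p x := by
  have h2 : ∀ᶠ ε in 𝓝[>] (0 : ℝ), ∀ j, ε < 𝒩.cmax j :=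
    eventually_all.2 fun j => (eventually_lt_nhds (h.cmax_pos j)).filter_mono nhdsWithin_le_nhds
  obtain ⟨ε, ⟨h1, h2⟩, h3⟩ :=
    (((h.eventually_mem_loadSet hz).and h2).and self_mem_nhdsWithin).exists
  have h3 : 0 < ε := h3
  refine ⟨fun _ => ε, ⟨fun x => ⟨h3.le, (h2 x.2).le⟩, ?_⟩, fun _ => h3⟩
  convert h1 using 3
  ring

theorem rateObjective_eq (𝒩 : Network N T) (z p : N → T → ℝ) :
    𝒩.rateObjective z p = ∑ x : N × T, (z x.1 x.2 : EReal) * 𝒩.u x.1 x.2 (p x.1 x.2) := by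
  rw [rateObjective, Fintype.sum_prod_type]

theorem Standing.exists_isChargingRate {𝒩 : Network N T} (h : 𝒩.Standing) {z : N → T → ℝ}
    (hz : ∀ i j, 0 ≤ z i j) : ∃ p, 𝒩.IsChargingRate z p := by
  classical
  -- where `z` vanishes, the rate is decoupled: any positive weight serves there
  let w : N × T → ℝ := fun x => if z x.1 x.2 = 0 then 1 else z x.1 x.2
  have hw : ∀ x, 0 < w x := fun x => by
    by_cases hx : z x.1 x.2 = 0
    · simp [w, hx]
    · simpa [w, hx] using lt_of_le_of_ne (hz _ _) (Ne.symm hx)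
  have hu : ∀ x : N × T, IsMarginal (𝒩.cmax x.2) (𝒩.u x.1 x.2) (derivE (𝒩.u x.1 x.2)) :=
    fun x => (h.utility x.1 x.2).isMarginal (h.cmax_pos x.2)
  obtain ⟨e, heC, he⟩ := h.exists_pos_mem_rateSet hz
  obtain ⟨m, hmC, hm, hfo, -⟩ := exists_strict_maximizer (fun x => (hu x).const_mul (hw x))
    (𝒩.convex_rateSet z) (h.isCompact_rateSet z) (fun p hp => hp.1) heC he
  have hmI : ∀ x, m x ∈ Ioc 0 (𝒩.cmax x.2) := fun x => ⟨hm x, (hmC.1 x).2⟩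
  have hzm : ∀ i j, z i j * (if z i j = 0 then 0 else m (i, j)) = z i j * m (i, j) :=
    fun i j => by by_cases hx : z i j = 0 <;> simp [hx]
  refine ⟨fun i j => if z i j = 0 then 0 else m (i, j), ?_, ?_, ?_⟩
  · rw [h.rateFeasible_iff hz]
    refine ⟨fun x => ?_, ?_⟩
    · by_cases hx : z x.1 x.2 = 0
      · simpa [hx] using (h.cmax_pos x.2).le
      · simpa [hx] using hmC.1 x
    · simpa only [hzm] using hmC.2
  · intro i j hx
    simp [hx]
  · intro p hp
    rw [h.rateFeasible_iff hz] at hp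
    have hobj : 𝒩.rateObjective z (fun i j => if z i j = 0 then 0 else m (i, j))
        = ((∑ x : N × T, z x.1 x.2 * (𝒩.u x.1 x.2 (m x)).toReal : ℝ) : EReal) := by
      rw [rateObjective_eq, ereal_coe_sum]
      refine Finset.sum_congr rfl fun x _ => ?_
      by_cases hx : z x.1 x.2 = 0
      · simp [hx]
      · rw [EReal.coe_mul, (hu x).coe _ (hmI x)]
        simp [hx]
    rw [hobj, rateObjective_eq]
    have hterm : ∀ x : N × T, (z x.1 x.2 : EReal) * 𝒩.u x.1 x.2 (p x.1 x.2) ≤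
        ((z x.1 x.2 * ((𝒩.u x.1 x.2 (m x)).toReal
          + derivE (𝒩.u x.1 x.2) (m x) * (p x.1 x.2 - m x)) : ℝ) : EReal) := fun x => by
      rw [EReal.coe_mul]
      exact mul_le_mul_of_nonneg_left ((hu x).le_tangent (hmI x) (hp.1 x))
        (EReal.coe_nonneg.2 (hz _ _))
    refine (sum_le_coe_sum hterm).trans (EReal.coe_le_coe_iff.2 ?_)
    -- The competitor is altered only where `z` vanishes. Its loads stay the same, and the
    -- artificial weights drop out of the first-order condition because `p''` agrees with `m` there.
    let p'' : N × T → ℝ := fun x => if z x.1 x.2 = 0 then m x else p x.1 x.2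
    have hp'' : p'' ∈ 𝒩.rateSet z := by
      refine ⟨fun x => ?_, ?_⟩
      · by_cases hx : z x.1 x.2 = 0
        · simpa [p'', hx] using hmC.1 x
        · simpa [p'', hx] using hp.1 x
      · have : ∀ i j, z i j * p'' (i, j) = z i j * p i j := fun i j => by
          by_cases hx : z i j = 0 <;> simp [p'', hx]
        simpa only [this] using hp.2
    have h1 := hfo p'' hp''
    have h2 : ∀ x : N × T, w x * derivE (𝒩.u x.1 x.2) (m x) * (p'' x - m x)
        = z x.1 x.2 * (derivE (𝒩.u x.1 x.2) (m x) * (p x.1 x.2 - m x)) := fun x => by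
      by_cases hx : z x.1 x.2 = 0
      · simp [p'', hx]
      · simp [p'', w, hx, mul_assoc]
    simp only [h2] at h1
    simp only [mul_add, Finset.sum_add_distrib]
    linarith

theorem Standing.rate_spec {𝒩 : Network N T} (h : 𝒩.Standing) {z : N → T → ℝ}
    (hz : ∀ i j, 0 ≤ z i j) : 𝒩.IsChargingRate z (𝒩.rate z) :=
  Classical.epsilon_spec (h.exists_isChargingRate hz)

/-- The first-order condition characterizes the charging rates in a positive state. -/
theorem Standing.rate_eq_iff {𝒩 : Network N T} (h : 𝒩.Standing) {z : N → T → ℝ}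
    (hz : ∀ i j, 0 < z i j) (p : N → T → ℝ) :
    𝒩.rate z = p ↔ (fun x => p x.1 x.2) ∈ 𝒩.rateSet z ∧ (∀ i j, 0 < p i j) ∧
      ∀ p' ∈ 𝒩.rateSet z, ∑ x : N × T,
        z x.1 x.2 * derivE (𝒩.u x.1 x.2) (p x.1 x.2) * (p' x - p x.1 x.2) ≤ 0 := by
  have hz' : ∀ i j, 0 ≤ z i j := fun i j => (hz i j).le
  have hf : ∀ x : N × T, IsMarginal (𝒩.cmax x.2) (fun y => (z x.1 x.2 : EReal) * 𝒩.u x.1 x.2 y)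
      (fun y => z x.1 x.2 * derivE (𝒩.u x.1 x.2) y) :=
    fun x => ((h.utility x.1 x.2).isMarginal (h.cmax_pos x.2)).const_mul (hz _ _)
  have hspec := h.rate_spec hz'
  have hfeas := (h.rateFeasible_iff hz' _).1 hspec.feasible
  constructor
  · rintro rfl
    obtain ⟨e, heC, he⟩ := h.exists_pos_mem_rateSet hz'
    obtain ⟨m, hmC, hm, hfo, hstrict⟩ := exists_strict_maximizer hf
      (𝒩.convex_rateSet z) (h.isCompact_rateSet z) (fun p hp => hp.1) heC he
    have heq : (fun x : N × T => 𝒩.rate z x.1 x.2) = m := by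
      by_contra hne
      have h1 := hstrict _ hfeas hne
      have h2 := hspec.optimal (fun i j => m (i, j)) ((h.rateFeasible_iff hz' _).2 hmC)
      rw [rateObjective_eq, rateObjective_eq] at h2
      exact absurd h1 h2.not_gt
    refine ⟨hfeas, fun i j => (hm (i, j)).trans_eq (congrFun heq (i, j)).symm, fun p' hp' => ?_⟩
    have := hfo p' hp'
    rwa [← heq] at this
  · rintro ⟨hp, hpos, hfo⟩
    by_contra hne
    have hne' : (fun x : N × T => 𝒩.rate z x.1 x.2) ≠ fun x => p x.1 x.2 := fun e =>
      hne (by ext i j; exact congrFun e (i, j))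
    have h1 := sum_lt_of_firstOrder hf (x := fun x => p x.1 x.2)
      (fun x => ⟨hpos _ _, (hp.1 x).2⟩) hfeas.1 hne' (hfo _ hfeas)
    have h2 := hspec.optimal p ((h.rateFeasible_iff hz' _).2 hp)
    rw [rateObjective_eq, rateObjective_eq] at h2
    exact absurd h1 h2.not_gt

end Network

/-! ### Continuous inverses and primitives on an interval. -/

/-- Closed subsets of the interval are compact, so `f` maps them to closed sets; these are the
preimages under the inverse. -/
theorem continuousOn_invFunOn_Icc {f : ℝ → ℝ} {a b : ℝ} (hc : ContinuousOn f (Icc a b))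
    (hinj : InjOn f (Icc a b)) :
    ContinuousOn (Function.invFunOn f (Icc a b)) (f '' Icc a b) := by
  rw [continuousOn_iff_isClosed]
  intro t ht
  refine ⟨f '' (t ∩ Icc a b), ((isCompact_Icc.inter_left ht).image_of_continuousOn
    (hc.mono inter_subset_right)).isClosed, ?_⟩
  ext y
  constructor
  · rintro ⟨hy, hy'⟩
    exact ⟨⟨_, ⟨hy, Function.invFunOn_mem hy'⟩, Function.invFunOn_eq hy'⟩, hy'⟩
  · rintro ⟨⟨x, ⟨hx, hx'⟩, rfl⟩, hy'⟩
    refine ⟨?_, hy'⟩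
    rw [mem_preimage, hinj.leftInvOn_invFunOn hx']
    exact hx

/-- A positive continuous function on `(0, c]` has a primitive that is continuous on `[0, c]` as
an extended-real-valued function. -/
theorem exists_primitive_Icc {c : ℝ} (hc : 0 < c) {ψ : ℝ → ℝ} (hψ : ContinuousOn ψ (Ioc 0 c))
    (hpos : ∀ y ∈ Ioc 0 c, 0 < ψ y) :
    ∃ G : ℝ → EReal, (∀ y ∈ Ioc 0 c, G y ≠ ⊥ ∧ G y ≠ ⊤) ∧ ContinuousOn G (Icc 0 c) ∧
      ∀ y ∈ Ioo 0 c, HasDerivAt (fun y => (G y).toReal) (ψ y) y := by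
  -- The base point is `c` because `ψ` need not be integrable near `0`. The value of `G` at `0` is
  -- the infimum of the increasing function `H`, hence its limit, possibly `-∞`.
  let H : ℝ → ℝ := fun y => ∫ s in c..y, ψ s
  have hint : ∀ x ∈ Ioc 0 c, ∀ y ∈ Ioc 0 c, IntervalIntegrable ψ volume x y := fun x hx y hy =>
    (hψ.mono ((ordConnected_Ioc).uIcc_subset hx hy)).intervalIntegrable
  have hcc : c ∈ Ioc 0 c := ⟨hc, le_rfl⟩
  have hder : ∀ y ∈ Ioo 0 c, HasDerivAt H (ψ y) y := fun y hy => by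
    refine intervalIntegral.integral_hasDerivAt_right (hint c hcc y (Ioo_subset_Ioc_self hy))
      ((hψ.mono Ioo_subset_Ioc_self).stronglyMeasurableAtFilter isOpen_Ioo y hy) ?_
    exact hψ.continuousAt (Ioc_mem_nhds hy.1 hy.2)
  have hcont : ContinuousOn H (Ioc 0 c) := fun y hy => by
    have hy2 : y / 2 ∈ Ioc 0 c := ⟨half_pos hy.1, by linarith [hy.1, hy.2]⟩
    have h1 := intervalIntegral.continuousOn_primitive_interval'
      (hint c hcc (y / 2) hy2) left_mem_uIcc
    rw [uIcc_of_ge hy2.2] at h1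
    refine (h1 y ⟨by linarith [hy.1], hy.2⟩).mono_of_mem_nhdsWithin ?_
    rw [mem_nhdsWithin]
    exact ⟨Ioi (y / 2), isOpen_Ioi, by simpa using hy.1, fun x hx => ⟨le_of_lt hx.1, hx.2.2⟩⟩
  have hmono : MonotoneOn H (Ioc 0 c) := by
    refine monotoneOn_of_deriv_nonneg (convex_Ioc _ _) hcont ?_ ?_ <;> rw [interior_Ioc]
    · exact fun y hy => (hder y hy).differentiableAt.differentiableWithinAt
    · intro y hy
      rw [(hder y hy).deriv]
      exact (hpos y (Ioo_subset_Ioc_self hy)).le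
  let G : ℝ → EReal := fun y =>
    if 0 < y then (H y : EReal) else sInf ((fun y => (H y : EReal)) '' Ioo 0 c)
  have hGpos : ∀ y, 0 < y → G y = H y := fun y hy => if_pos hy
  refine ⟨G, fun y hy => ?_, fun y hy => ?_, fun y hy => ?_⟩
  · rw [hGpos y hy.1]
    exact ⟨EReal.coe_ne_bot _, EReal.coe_ne_top _⟩
  · rcases hy.1.eq_or_lt with rfl | hy0
    · suffices h : ContinuousWithinAt G (Ioi 0) 0 from
        (continuousWithinAt_Ioi_iff_Ici.1 h).mono fun x hx => hx.1
      have h1 : Tendsto (fun y => (H y : EReal)) (𝓝[>] 0)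
          (𝓝 (sInf ((fun y => (H y : EReal)) '' Ioo 0 c))) := by
        refine MonotoneOn.tendsto_nhdsWithin_Ioo_right (nonempty_Ioo.2 hc) ?_ (OrderBot.bddBelow _)
        exact fun x hx y hy hxy => EReal.coe_le_coe_iff.2
          (hmono (Ioo_subset_Ioc_self hx) (Ioo_subset_Ioc_self hy) hxy)
      have h2 : G 0 = sInf ((fun y => (H y : EReal)) '' Ioo 0 c) := if_neg (lt_irrefl _)
      rw [ContinuousWithinAt, h2]
      refine h1.congr' ?_
      filter_upwards [self_mem_nhdsWithin] with x hx using (hGpos x hx).symm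
    · have h1 : ContinuousWithinAt (fun y => (H y : EReal)) (Icc 0 c) y := by
        refine continuous_coe_real_ereal.continuousAt.comp_continuousWithinAt ?_
        refine (hcont y ⟨hy0, hy.2⟩).mono_of_mem_nhdsWithin ?_
        rw [mem_nhdsWithin]
        exact ⟨Ioi 0, isOpen_Ioi, hy0, fun x hx => ⟨hx.1, hx.2.2⟩⟩
      refine h1.congr_of_eventuallyEq ?_ (hGpos y hy0)
      filter_upwards [nhdsWithin_le_nhds (lt_mem_nhds hy0)] with x hx using hGpos x hx
  · refine (hder y hy).congr_of_eventuallyEq ?_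
    filter_upwards [lt_mem_nhds hy.1] with x hx
    rw [hGpos x hx, EReal.toReal_coe]

/-! ### The functions `g` and their inverses. -/

namespace Network

variable {N T : Type*}

section

variable {𝒩 : Network N T}

theorem Standing.integral_pos_of_ae_pos (h : 𝒩.Standing) (j : T) {f : ℝ × ℝ → ℝ}
    (hf : Integrable f (𝒩.F j)) (hpos : ∀ᵐ y ∂𝒩.F j, 0 < f y) : 0 < ∫ y, f y ∂𝒩.F j := by
  have := h.prob j
  have h0 : 0 ≤ᵐ[𝒩.F j] f := hpos.mono fun y hy => hy.le
  refine lt_of_le_of_ne (integral_nonneg_of_ae h0) fun e => ?_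
  have h1 := (integral_eq_zero_iff_of_nonneg_ae h0 hf).1 e.symm
  obtain ⟨y, hy, hy'⟩ := (h1.and hpos).exists
  exact hy'.ne' hy

theorem Standing.meanD_pos (h : 𝒩.Standing) (j : T) : 0 < 𝒩.meanD j :=
  h.integral_pos_of_ae_pos j (h.D_integrable j) (h.D_pos j)

theorem Standing.integrable_min (h : 𝒩.Standing) (j : T) {x : ℝ} (hx : 0 ≤ x) :
    Integrable (fun y : ℝ × ℝ => min (y.2 * x) y.1) (𝒩.F j) := by
  refine ((h.D_integrable j).mul_const x).mono' (by fun_prop) ?_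
  filter_upwards [h.B_pos j, h.D_pos j] with y hB hD
  have : 0 ≤ y.2 * x := mul_nonneg hD.le hx
  rw [Real.norm_of_nonneg (le_min this hB.le)]
  exact min_le_left _ _

theorem Standing.integrable_sojourn (h : 𝒩.Standing) (j : T) {p : ℝ} (hp : 0 ≤ p) :
    Integrable (fun y : ℝ × ℝ => sojourn y.1 y.2 p) (𝒩.F j) := by
  by_cases h0 : p = 0
  · simpa [sojourn, h0] using h.D_integrable j
  · simp only [sojourn, h0, if_false]
    refine (h.D_integrable j).mono' (by fun_prop) ?_
    filter_upwards [h.B_pos j, h.D_pos j] with y hB hD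
    rw [Real.norm_of_nonneg (le_min hD.le (div_nonneg hB.le hp))]
    exact min_le_left _ _

theorem Standing.integral_sojourn_pos (h : 𝒩.Standing) (j : T) {p : ℝ} (hp : 0 ≤ p) :
    0 < ∫ y, sojourn y.1 y.2 p ∂𝒩.F j := by
  refine h.integral_pos_of_ae_pos j (h.integrable_sojourn j hp) ?_
  filter_upwards [h.B_pos j, h.D_pos j] with y hB hD
  unfold sojourn
  split_ifs with h0
  · exact hD
  · exact lt_min hD (div_pos hB (lt_of_le_of_ne hp (Ne.symm h0)))

/-- This identity turns the fixed-point equation into `z p = g(p)`. -/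
theorem integral_sojourn_mul (𝒩 : Network N T) (j : T) {p : ℝ} (hp : 0 < p) :
    (∫ y, sojourn y.1 y.2 p ∂𝒩.F j) * p = ∫ y, min (y.2 * p) y.1 ∂𝒩.F j := by
  rw [← integral_mul_const]
  refine integral_congr_ae (Eventually.of_forall fun y => ?_)
  simp only [sojourn, hp.ne', if_false]
  rw [min_mul_of_nonneg _ _ hp.le, div_mul_cancel₀ _ hp.ne']

end

variable [Fintype T] {𝒩 : Network N T}

theorem Standing.lamTot_pos (h : 𝒩.Standing) (i : N) (j : T) : 0 < 𝒩.lamTot i :=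
  Finset.sum_pos (fun j _ => h.lam_pos i j) ⟨j, Finset.mem_univ j⟩

/-- The total arrival rate cancels, leaving `lam` times the long-run admitted fraction computed in
`tendsto_average_admission`. -/
theorem Standing.gam_eq (h : 𝒩.Standing) (i : N) (j : T) :
    𝒩.gam i j = 𝒩.lam i j * min 1 (𝒩.K i / ∑ j', 𝒩.lam i j' * 𝒩.meanD j') := by
  have hl := h.lamTot_pos i j
  have e : ∑ j', 𝒩.lam i j' / 𝒩.lamTot i * 𝒩.meanD j'
      = (∑ j', 𝒩.lam i j' * 𝒩.meanD j') / 𝒩.lamTot i := by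
    rw [Finset.sum_div]
    exact Finset.sum_congr rfl fun _ _ => by ring
  rw [gam, e, div_mul_eq_mul_div, mul_div_assoc, ← min_div_div_right hl.le, div_self hl.ne']
  congr 2
  field_simp

theorem Standing.sum_lam_meanD_pos (h : 𝒩.Standing) (i : N) (j : T) :
    0 < ∑ j', 𝒩.lam i j' * 𝒩.meanD j' :=
  Finset.sum_pos (fun j _ => mul_pos (h.lam_pos i j) (h.meanD_pos j)) ⟨j, Finset.mem_univ j⟩

theorem Standing.gam_pos (h : 𝒩.Standing) (i : N) (j : T) : 0 < 𝒩.gam i j := by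
  rw [h.gam_eq i j]
  exact mul_pos (h.lam_pos i j)
    (lt_min one_pos (div_pos (h.K_pos i) (h.sum_lam_meanD_pos i j)))

theorem Standing.g_zero (h : 𝒩.Standing) (i : N) (j : T) : 𝒩.g i j 0 = 0 := by
  have : ∫ y : ℝ × ℝ, min (y.2 * 0) y.1 ∂𝒩.F j = ∫ _y : ℝ × ℝ, (0 : ℝ) ∂𝒩.F j := by
    refine integral_congr_ae ?_
    filter_upwards [h.B_pos j] with y hB
    simp [hB.le]
  rw [g, this]
  simp

theorem Standing.continuousOn_g (h : 𝒩.Standing) (i : N) (j : T) :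
    ContinuousOn (𝒩.g i j) (Icc 0 (𝒩.cmax j)) := by
  refine continuousOn_const.mul (continuousOn_of_dominated (bound := fun y => y.2 * 𝒩.cmax j)
    (fun x _ => by fun_prop) (fun x hx => ?_) ((h.D_integrable j).mul_const _)
    (Eventually.of_forall fun y => by fun_prop))
  filter_upwards [h.B_pos j, h.D_pos j] with y hB hD
  have : 0 ≤ y.2 * x := mul_nonneg hD.le hx.1
  rw [Real.norm_of_nonneg (le_min this hB.le)]
  exact (min_le_left _ _).trans (mul_le_mul_of_nonneg_left hx.2 hD.le)

/-- If `g` took equal values at `x < y`, the two ordered integrands would agree almost surely, which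
forces `B ≤ D x` almost surely. For `x = 0` this contradicts `B > 0`. Otherwise `D / B ≥ 1 / x > 1 /
cmax` almost surely, so the support starts beyond `1 / cmax`. -/
theorem Standing.strictMonoOn_g (h : 𝒩.Standing) (i : N) {j : T}
    (hleft : leftmost ((𝒩.F j).map (fun x => x.2 / x.1)) ≤ 1 / 𝒩.cmax j) :
    StrictMonoOn (𝒩.g i j) (Icc 0 (𝒩.cmax j)) := by
  intro x hx y hy hxy
  have := h.prob j
  refine mul_lt_mul_of_pos_left ?_ (h.gam_pos i j)
  have hix := h.integrable_min j hx.1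
  have hiy := h.integrable_min j hy.1
  have hle : ∀ᵐ w ∂𝒩.F j, min (w.2 * x) w.1 ≤ min (w.2 * y) w.1 := by
    filter_upwards [h.D_pos j] with w hD
    exact min_le_min_right _ (mul_le_mul_of_nonneg_left hxy.le hD.le)
  refine lt_of_le_of_ne (integral_mono_ae hix hiy hle) fun e => ?_
  have hsub : ∫ w, (min (w.2 * y) w.1 - min (w.2 * x) w.1) ∂𝒩.F j = 0 := by
    rw [integral_sub hiy hix, e, sub_self]
  have h0 := (integral_eq_zero_iff_of_nonneg_ae (hle.mono fun w hw => sub_nonneg.2 hw)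
    (hiy.sub hix)).1 hsub
  have hBD : ∀ᵐ w ∂𝒩.F j, 0 < w.1 ∧ w.1 ≤ w.2 * x := by
    filter_upwards [h0, h.B_pos j, h.D_pos j] with w hw hB hD
    refine ⟨hB, ?_⟩
    by_contra hlt
    push Not at hlt
    have h1 : w.2 * x < min (w.2 * y) w.1 := lt_min (mul_lt_mul_of_pos_left hxy hD) hlt
    have h2 : min (w.2 * y) w.1 - min (w.2 * x) w.1 = 0 := hw
    rw [min_eq_left hlt.le] at h2
    linarith
  rcases hx.1.eq_or_lt with rfl | hx0
  · obtain ⟨w, hw⟩ := hBD.exists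
    linarith
  · have hmeas : Measurable fun w : ℝ × ℝ => w.2 / w.1 := by fun_prop
    have := Measure.isProbabilityMeasure_map (μ := 𝒩.F j) hmeas.aemeasurable
    have hsupp : ((𝒩.F j).map (fun x => x.2 / x.1)).support ⊆ Ici (1 / x) := by
      refine Measure.support_subset_of_isClosed isClosed_Ici ?_
      rw [mem_ae_map_iff hmeas.aemeasurable measurableSet_Ici]
      filter_upwards [hBD] with w hw
      rw [mem_preimage, mem_Ici, div_le_div_iff₀ hx0 hw.1]
      linarith
    have hne := Measure.nonempty_support (IsProbabilityMeasure.ne_zero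
      ((𝒩.F j).map (fun x => x.2 / x.1)))
    have h1 : 1 / x ≤ leftmost ((𝒩.F j).map (fun x => x.2 / x.1)) :=
      le_csInf hne fun w hw => hsupp hw
    have h2 := one_div_lt_one_div_of_lt hx0 (hxy.trans_le hy.2)
    linarith

/-- The leftmost point of the support of `D_j / B_j` is at most `1 / c_j^max`. -/
def ShortStay (𝒩 : Network N T) : Prop :=
  ∀ j, leftmost ((𝒩.F j).map (fun x => x.2 / x.1)) ≤ 1 / 𝒩.cmax j

theorem Standing.g_cmax_pos (h : 𝒩.Standing) (hs : 𝒩.ShortStay) (i : N) (j : T) :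
    0 < 𝒩.g i j (𝒩.cmax j) := by
  have hc := h.cmax_pos j
  rw [← h.g_zero i j]
  exact h.strictMonoOn_g i (hs j) ⟨le_rfl, hc.le⟩ ⟨hc.le, le_rfl⟩ hc

theorem Standing.image_g (h : 𝒩.Standing) (hs : 𝒩.ShortStay) (i : N) (j : T) :
    𝒩.g i j '' Icc 0 (𝒩.cmax j) = Icc 0 (𝒩.g i j (𝒩.cmax j)) := by
  have hc := (h.cmax_pos j).le
  refine Subset.antisymm ?_ ?_
  · rintro _ ⟨x, hx, rfl⟩
    have hm := (h.strictMonoOn_g i (hs j)).monotoneOn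
    refine ⟨?_, hm hx ⟨hc, le_rfl⟩ hx.2⟩
    rw [← h.g_zero i j]
    exact hm ⟨le_rfl, hc⟩ hx hx.1
  · have := intermediate_value_Icc hc (h.continuousOn_g i j)
    rwa [h.g_zero i j] at this

theorem Standing.gInv_mem (h : 𝒩.Standing) (hs : 𝒩.ShortStay) {i : N} {j : T} {y : ℝ}
    (hy : y ∈ Icc 0 (𝒩.g i j (𝒩.cmax j))) : 𝒩.gInv i j y ∈ Icc 0 (𝒩.cmax j) := by
  rw [← h.image_g hs] at hy
  exact Function.invFunOn_mem hy

theorem Standing.g_gInv (h : 𝒩.Standing) (hs : 𝒩.ShortStay) {i : N} {j : T} {y : ℝ}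
    (hy : y ∈ Icc 0 (𝒩.g i j (𝒩.cmax j))) : 𝒩.g i j (𝒩.gInv i j y) = y := by
  rw [← h.image_g hs] at hy
  exact Function.invFunOn_eq hy

theorem Standing.gInv_g (h : 𝒩.Standing) (hs : 𝒩.ShortStay) {i : N} {j : T} {x : ℝ}
    (hx : x ∈ Icc 0 (𝒩.cmax j)) : 𝒩.gInv i j (𝒩.g i j x) = x :=
  (h.strictMonoOn_g i (hs j)).injOn.leftInvOn_invFunOn hx

theorem Standing.gInv_zero (h : 𝒩.Standing) (hs : 𝒩.ShortStay) (i : N) (j : T) :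
    𝒩.gInv i j 0 = 0 := by
  have := h.gInv_g hs (i := i) (j := j) (x := 0) ⟨le_rfl, (h.cmax_pos j).le⟩
  rwa [h.g_zero] at this

theorem Standing.strictMonoOn_gInv (h : 𝒩.Standing) (hs : 𝒩.ShortStay) (i : N) (j : T) :
    StrictMonoOn (𝒩.gInv i j) (Icc 0 (𝒩.g i j (𝒩.cmax j))) := by
  intro x hx y hy hxy
  rw [← (h.strictMonoOn_g i (hs j)).lt_iff_lt (h.gInv_mem hs hx) (h.gInv_mem hs hy),
    h.g_gInv hs hx, h.g_gInv hs hy]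
  exact hxy

theorem Standing.continuousOn_gInv (h : 𝒩.Standing) (hs : 𝒩.ShortStay) (i : N) (j : T) :
    ContinuousOn (𝒩.gInv i j) (Icc 0 (𝒩.g i j (𝒩.cmax j))) := by
  rw [← h.image_g hs]
  exact continuousOn_invFunOn_Icc (h.continuousOn_g i j) (h.strictMonoOn_g i (hs j)).injOn

theorem Standing.gInv_pos (h : 𝒩.Standing) (hs : 𝒩.ShortStay) {i : N} {j : T} {y : ℝ}
    (hy : y ∈ Ioc 0 (𝒩.g i j (𝒩.cmax j))) : 0 < 𝒩.gInv i j y := by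
  rw [← h.gInv_zero hs i j]
  exact h.strictMonoOn_gInv hs i j ⟨le_rfl, (h.g_cmax_pos hs i j).le⟩ (Ioc_subset_Icc_self hy) hy.1

/-! ### The primitives `G_ij` -/

/-- The prescribed derivative `u_ij' ∘ g_ij⁻¹`. -/
def marginal (𝒩 : Network N T) (i : N) (j : T) (y : ℝ) : ℝ := derivE (𝒩.u i j) (𝒩.gInv i j y)

theorem Standing.continuousOn_marginal (h : 𝒩.Standing) (hs : 𝒩.ShortStay) (i : N) (j : T) :
    ContinuousOn (𝒩.marginal i j) (Ioc 0 (𝒩.g i j (𝒩.cmax j))) :=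
  (h.utility i j).continuousOn_derivE.comp
    ((h.continuousOn_gInv hs i j).mono Ioc_subset_Icc_self) fun _ hy => h.gInv_pos hs hy

theorem Standing.strictAntiOn_marginal (h : 𝒩.Standing) (hs : 𝒩.ShortStay) (i : N) (j : T) :
    StrictAntiOn (𝒩.marginal i j) (Ioc 0 (𝒩.g i j (𝒩.cmax j))) := fun _ hx _ hy hxy =>
  (h.utility i j).strictAntiOn_derivE (h.gInv_pos hs hx) (h.gInv_pos hs hy)
    (h.strictMonoOn_gInv hs i j (Ioc_subset_Icc_self hx) (Ioc_subset_Icc_self hy) hxy)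

theorem Standing.marginal_pos (h : 𝒩.Standing) (hs : 𝒩.ShortStay) {i : N} {j : T} {y : ℝ}
    (hy : y ∈ Ioc 0 (𝒩.g i j (𝒩.cmax j))) : 0 < 𝒩.marginal i j y :=
  (h.utility i j).derivE_pos (h.gInv_pos hs hy)

theorem Standing.tendsto_marginal (h : 𝒩.Standing) (hs : 𝒩.ShortStay) (i : N) (j : T) :
    Tendsto (𝒩.marginal i j) (𝓝[>] 0) atTop := by
  have hg := h.g_cmax_pos hs i j
  refine (h.utility i j).slope.comp (tendsto_nhdsWithin_iff.2 ⟨?_, ?_⟩)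
  · have := (h.continuousOn_gInv hs i j) 0 ⟨le_rfl, hg.le⟩
    rw [ContinuousWithinAt, h.gInv_zero hs] at this
    rw [← nhdsWithin_Ioc_eq_nhdsGT hg]
    exact this.mono_left (nhdsWithin_mono _ Ioc_subset_Icc_self)
  · filter_upwards [Ioc_mem_nhdsGT hg] with y hy using h.gInv_pos hs hy

/-- The derivative `u' ∘ g⁻¹` inherits positivity, strict decrease and the blow-up at `0` from `u'`,
since `g⁻¹` increases strictly and continuously from `0`. Continuity of `G` at `0` gives that `G 0`
is its least value. -/
theorem IsPrimitive.isMarginal (h : 𝒩.Standing) (hs : 𝒩.ShortStay) {i : N} {j : T}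
    {G : ℝ → EReal} (hG : 𝒩.IsPrimitive i j G) :
    IsMarginal (𝒩.g i j (𝒩.cmax j)) G (𝒩.marginal i j) := by
  have hg := h.g_cmax_pos hs i j
  have hcont : ContinuousOn (fun y => (G y).toReal) (Ioc 0 (𝒩.g i j (𝒩.cmax j))) := by
    refine EReal.continuousOn_toReal.comp (hG.continuous.mono Ioc_subset_Icc_self) fun y hy => ?_
    have := hG.finite y hy
    simp [this.1, this.2]
  have hmono : MonotoneOn (fun y => (G y).toReal) (Ioc 0 (𝒩.g i j (𝒩.cmax j))) := by
    refine monotoneOn_of_deriv_nonneg (convex_Ioc _ _) hcont ?_ ?_ <;> rw [interior_Ioc]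
    · exact fun y hy => (hG.hasDeriv y hy).differentiableAt.differentiableWithinAt
    · intro y hy
      rw [(hG.hasDeriv y hy).deriv]
      exact (h.marginal_pos hs (Ioo_subset_Ioc_self hy)).le
  have hcoe : ∀ x ∈ Ioc 0 (𝒩.g i j (𝒩.cmax j)), ((G x).toReal : EReal) = G x := fun x hx =>
    EReal.coe_toReal (hG.finite x hx).2 (hG.finite x hx).1
  refine IsMarginal.of_hasDerivAt hg hG.finite (fun x hx => ?_) hcont hG.hasDeriv
    (h.strictAntiOn_marginal hs i j) (h.continuousOn_marginal hs i j)
    (fun y hy => (h.marginal_pos hs hy).le) (h.tendsto_marginal hs i j)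
  have hlim : Tendsto G (𝓝[>] 0) (𝓝 (G 0)) := by
    rw [← nhdsWithin_Ioc_eq_nhdsGT hg]
    exact (hG.continuous 0 ⟨le_rfl, hg.le⟩).mono_left (nhdsWithin_mono _ Ioc_subset_Icc_self)
  refine le_of_tendsto hlim ?_
  filter_upwards [Ioc_mem_nhdsGT hx.1] with s hs'
  have hs'' : s ∈ Ioc 0 (𝒩.g i j (𝒩.cmax j)) := ⟨hs'.1, hs'.2.trans hx.2⟩
  rw [← hcoe s hs'', ← hcoe x hx, EReal.coe_le_coe_iff]
  exact hmono hs'' hx hs'.2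

theorem Standing.exists_isPrimitive (h : 𝒩.Standing) (hs : 𝒩.ShortStay) (i : N) (j : T) :
    ∃ G, 𝒩.IsPrimitive i j G := by
  obtain ⟨G, h1, h2, h3⟩ := exists_primitive_Icc (h.g_cmax_pos hs i j)
    (h.continuousOn_marginal hs i j) (fun y hy => h.marginal_pos hs hy)
  exact ⟨G, h1, h2, h3⟩

end Network

/-! ### Equivalence of fixed points and optimal power flows. -/

/-- The first-order condition at `a` over a convex set intersected with a box depends only on the
sides of the box that are active at `a`. -/
theorem firstOrder_of_box {ι : Type*} [Fintype ι] {V : Set (ι → ℝ)} (hV : Convex ℝ V)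
    {a b b' ψ : ι → ℝ} (ha : a ∈ V) (hab : ∀ i, a i ≤ b i) (hact : ∀ i, a i < b i ∨ b' i ≤ a i)
    (hfo : ∀ y ∈ V, (∀ i, y i ≤ b i) → ∑ i, ψ i * (y i - a i) ≤ 0) :
    ∀ y ∈ V, (∀ i, y i ≤ b' i) → ∑ i, ψ i * (y i - a i) ≤ 0 := by
  intro y hy hyb
  -- A short step from `a` towards `y` respects `b`: coordinates with `a i < b i` have room, and in
  -- the others `y i ≤ b' i ≤ a i`, so the step does not go up. The condition scales linearly with
  -- the step.
  have hev : ∀ᶠ t in 𝓝[>] (0 : ℝ), ∀ i, a i + t * (y i - a i) ≤ b i := by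
    refine eventually_all.2 fun i => ?_
    rcases hact i with hi | hi
    · have : Tendsto (fun t : ℝ => a i + t * (y i - a i)) (𝓝 0) (𝓝 (a i + 0 * (y i - a i))) :=
        Continuous.tendsto (by fun_prop) _
      exact (this.eventually (ge_mem_nhds (by simpa using hi))).filter_mono nhdsWithin_le_nhds
    · filter_upwards [self_mem_nhdsWithin] with t ht
      have ht : 0 < t := ht
      nlinarith [hyb i, hab i]
  obtain ⟨t, hbox, ht⟩ := (hev.and (Ioo_mem_nhdsGT (zero_lt_one' ℝ))).exists
  have h1 := hfo (a + t • (y - a)) (hV.add_smul_sub_mem ha hy ⟨ht.1.le, ht.2.le⟩) hbox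
  have h2 : ∑ i, ψ i * ((a + t • (y - a)) i - a i) = t * ∑ i, ψ i * (y i - a i) := by
    rw [Finset.mul_sum]
    refine Finset.sum_congr rfl fun i _ => ?_
    simp only [Pi.add_apply, Pi.smul_apply, Pi.sub_apply, smul_eq_mul]
    ring
  rw [h2] at h1
  exact nonpos_of_mul_nonpos_right h1 ht.1

namespace Network

variable {N T : Type*} [Fintype N] [Fintype T]

/-- The feasible loads, indexed by pairs of a node and a type. -/
def loadSet₂ (𝒩 : Network N T) : Set (N × T → ℝ) := {y | (fun i j => y (i, j)) ∈ 𝒩.loadSet}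

theorem convex_loadSet₂ (𝒩 : Network N T) : Convex ℝ 𝒩.loadSet₂ :=
  fun _ hx _ hy _ _ ha hb hab => 𝒩.convex_loadSet hx hy ha hb hab

/-- The `Λ`-parts of the feasible points of the relaxed optimal power flow problem. -/
def opfSet (𝒩 : Network N T) : Set (N × T → ℝ) :=
  {y | y ∈ 𝒩.loadSet₂ ∧ ∀ x, y x ≤ 𝒩.g x.1 x.2 (𝒩.cmax x.2)}

variable {𝒩 : Network N T}

theorem exists_opfFeasible_iff (Λ : N → T → ℝ) :
    (∃ W, 𝒩.OPFFeasible Λ W) ↔ (fun x => Λ x.1 x.2) ∈ 𝒩.opfSet := by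
  constructor
  · rintro ⟨W, hW⟩
    exact ⟨⟨hW.nonneg, hW.load, W, hW.voltage⟩, fun x => hW.le_max _ _⟩
  · rintro ⟨⟨h0, hM, W, hW⟩, hle⟩
    exact ⟨W, hW, hM, h0, fun i j => hle (i, j)⟩

theorem isOPFSolution_iff (G : N → T → ℝ → EReal) (Λ : N → T → ℝ) :
    𝒩.IsOPFSolution G Λ ↔ (fun x => Λ x.1 x.2) ∈ 𝒩.opfSet ∧
      ∀ y ∈ 𝒩.opfSet, ∑ x, G x.1 x.2 (y x) ≤ ∑ x : N × T, G x.1 x.2 (Λ x.1 x.2) := by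
  rw [IsOPFSolution, exists_opfFeasible_iff]
  refine and_congr_right fun _ => ⟨fun hopt y hy => ?_, fun hopt Λ' W' hΛ' => ?_⟩
  · obtain ⟨W, hW⟩ := (exists_opfFeasible_iff (𝒩 := 𝒩) fun i j => y (i, j)).2 hy
    simpa only [Fintype.sum_prod_type] using hopt _ W hW
  · have := hopt _ ((exists_opfFeasible_iff Λ').1 ⟨W', hΛ'⟩)
    simpa only [Fintype.sum_prod_type] using this

theorem convex_opfSet (𝒩 : Network N T) : Convex ℝ 𝒩.opfSet :=
  fun _ hx _ hy _ _ ha hb hab => ⟨𝒩.convex_loadSet₂ hx.1 hy.1 ha hb hab,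
    fun x => convex_Iic (𝒩.g x.1 x.2 (𝒩.cmax x.2)) (hx.2 x) (hy.2 x) ha hb hab⟩

theorem Standing.isCompact_opfSet (h : 𝒩.Standing) : IsCompact 𝒩.opfSet := by
  have h1 : IsCompact 𝒩.loadSet₂ := by
    have e : 𝒩.loadSet₂ = (fun (Λ : N → T → ℝ) (x : N × T) => Λ x.1 x.2) '' 𝒩.loadSet := by
      ext y
      refine ⟨fun hy => ⟨_, hy, rfl⟩, ?_⟩
      rintro ⟨Λ, hΛ, rfl⟩
      exact hΛ
    rw [e]
    exact h.isCompact_loadSet.image (by fun_prop)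
  refine h1.inter_right (t := {y | ∀ x, y x ≤ 𝒩.g x.1 x.2 (𝒩.cmax x.2)}) ?_
  simp only [ofPred_forall]
  exact isClosed_iInter fun x => isClosed_le (continuous_apply x) continuous_const

theorem mem_Icc_of_mem_opfSet {y : N × T → ℝ} (hy : y ∈ 𝒩.opfSet) (x : N × T) :
    y x ∈ Icc 0 (𝒩.g x.1 x.2 (𝒩.cmax x.2)) :=
  ⟨hy.1.1 x.1 x.2, hy.2 x⟩

theorem Standing.exists_strict_opf (h : 𝒩.Standing) (hs : 𝒩.ShortStay)
    {G : N → T → ℝ → EReal} (hG : ∀ i j, 𝒩.IsPrimitive i j (G i j)) :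
    ∃ m ∈ 𝒩.opfSet, (∀ x, 0 < m x) ∧
      (∀ y ∈ 𝒩.opfSet, ∑ x, 𝒩.marginal x.1 x.2 (m x) * (y x - m x) ≤ 0) ∧
      ∀ y ∈ 𝒩.opfSet, y ≠ m → ∑ x, G x.1 x.2 (y x) < ∑ x : N × T, G x.1 x.2 (m x) := by
  have h2 : ∀ᶠ ε in 𝓝[>] (0 : ℝ), ∀ x : N × T, ε < 𝒩.g x.1 x.2 (𝒩.cmax x.2) :=
    eventually_all.2 fun x =>
      (eventually_lt_nhds (h.g_cmax_pos hs x.1 x.2)).filter_mono nhdsWithin_le_nhds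
  obtain ⟨ε, ⟨h1, h2⟩, h3⟩ := (((h.eventually_mem_loadSet (Λ := fun _ _ => 1)
    (fun _ _ => zero_le_one)).and h2).and self_mem_nhdsWithin).exists
  have h3 : 0 < ε := h3
  simp only [mul_one] at h1
  exact exists_strict_maximizer (fun x : N × T => (hG x.1 x.2).isMarginal h hs)
    𝒩.convex_opfSet h.isCompact_opfSet (fun y hy x => mem_Icc_of_mem_opfSet hy x)
    (e := fun _ => ε) ⟨h1, fun x => (h2 x).le⟩ (fun _ => h3)

theorem Standing.existsUnique_opf (h : 𝒩.Standing) (hs : 𝒩.ShortStay)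
    {G : N → T → ℝ → EReal} (hG : ∀ i j, 𝒩.IsPrimitive i j (G i j)) :
    ∃! Λ, 𝒩.IsOPFSolution G Λ := by
  obtain ⟨m, hm, -, -, hstrict⟩ := h.exists_strict_opf hs hG
  refine ⟨fun i j => m (i, j), (isOPFSolution_iff _ _).2 ⟨hm, fun y hy => ?_⟩, fun Λ hΛ => ?_⟩
  · rcases eq_or_ne y m with rfl | hne
    · exact le_rfl
    · exact (hstrict y hy hne).le
  · replace hΛ := (isOPFSolution_iff _ _).1 hΛ
    by_contra hne
    have hne' : (fun x : N × T => Λ x.1 x.2) ≠ m := fun e =>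
      hne (by ext i j; exact congrFun e (i, j))
    exact absurd (hstrict _ hΛ.1 hne') (hΛ.2 m hm).not_gt

theorem Standing.isOPFSolution_iff_firstOrder (h : 𝒩.Standing) (hs : 𝒩.ShortStay)
    {G : N → T → ℝ → EReal} (hG : ∀ i j, 𝒩.IsPrimitive i j (G i j)) (Λ : N → T → ℝ) :
    𝒩.IsOPFSolution G Λ ↔ (fun x => Λ x.1 x.2) ∈ 𝒩.opfSet ∧ (∀ i j, 0 < Λ i j) ∧
      ∀ y ∈ 𝒩.opfSet, ∑ x : N × T, 𝒩.marginal x.1 x.2 (Λ x.1 x.2) * (y x - Λ x.1 x.2) ≤ 0 := by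
  constructor
  · intro hΛ
    obtain ⟨m, hm, hpos, hfo, hstrict⟩ := h.exists_strict_opf hs hG
    have hm' : 𝒩.IsOPFSolution G (fun i j => m (i, j)) := by
      refine (isOPFSolution_iff _ _).2 ⟨hm, fun y hy => ?_⟩
      rcases eq_or_ne y m with rfl | hne
      · exact le_rfl
      · exact (hstrict y hy hne).le
    obtain rfl := (h.existsUnique_opf hs hG).unique hΛ hm'
    exact ⟨hm, fun i j => hpos (i, j), hfo⟩
  · rintro ⟨hΛ, hpos, hfo⟩
    refine (isOPFSolution_iff _ _).2 ⟨hΛ, fun y hy => ?_⟩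
    by_cases hne : y = fun x => Λ x.1 x.2
    · rw [hne]
    · exact (sum_lt_of_firstOrder (fun x : N × T => (hG x.1 x.2).isMarginal h hs)
        (x := fun x => Λ x.1 x.2) (fun x => ⟨hpos _ _, hΛ.2 x⟩)
        (mem_Icc_of_mem_opfSet hy) hne (hfo y hy)).le

/-- The charging rates in a positive state, characterized in terms of loads. -/
theorem Standing.rate_eq_iff_load (h : 𝒩.Standing) {z : N → T → ℝ}
    (hz : ∀ i j, 0 < z i j) (p : N → T → ℝ) :
    𝒩.rate z = p ↔ (∀ i j, p i j ∈ Ioc 0 (𝒩.cmax j)) ∧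
      (fun x => z x.1 x.2 * p x.1 x.2) ∈ 𝒩.loadSet₂ ∧
      ∀ y ∈ 𝒩.loadSet₂, (∀ x, y x ≤ z x.1 x.2 * 𝒩.cmax x.2) →
        ∑ x : N × T, derivE (𝒩.u x.1 x.2) (p x.1 x.2) * (y x - z x.1 x.2 * p x.1 x.2) ≤ 0 := by
  rw [h.rate_eq_iff hz]
  constructor
  · rintro ⟨hp, hpos, hfo⟩
    refine ⟨fun i j => ⟨hpos i j, (hp.1 (i, j)).2⟩, hp.2, fun y hy hyb => ?_⟩
    -- Substituting `y = z p'`, the weight `z` in the marginal is absorbed by the change of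
    -- variables, which leaves the gradient `u'(p)`.
    have hyz : ∀ x : N × T, z x.1 x.2 * (y x / z x.1 x.2) = y x := fun x =>
      mul_div_cancel₀ _ (hz _ _).ne'
    have h1 := hfo (fun x => y x / z x.1 x.2) ⟨fun x => ⟨div_nonneg (hy.1 _ _) (hz _ _).le,
      (div_le_iff₀' (hz _ _)).2 (hyb x)⟩, by
        simp only [fun i j => hyz (i, j)]
        exact hy⟩
    refine (le_of_eq (Finset.sum_congr rfl fun x _ => ?_)).trans h1
    linear_combination -derivE (𝒩.u x.1 x.2) (p x.1 x.2) * hyz x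
  · rintro ⟨hp, hload, hfo⟩
    refine ⟨⟨fun x => Ioc_subset_Icc_self (hp _ _), hload⟩, fun i j => (hp i j).1, fun p' hp' => ?_⟩
    have h1 := hfo (fun x => z x.1 x.2 * p' x) hp'.2
      (fun x => mul_le_mul_of_nonneg_left (hp'.1 x).2 (hz _ _).le)
    refine (le_of_eq (Finset.sum_congr rfl fun x _ => ?_)).trans h1
    ring

/-- When the loads `z p` equal `g(p)`, the charging rates in state `z` are `p` exactly if the loads
solve the relaxed optimal power flow problem. -/
theorem Standing.rate_eq_iff_opf (h : 𝒩.Standing) (hs : 𝒩.ShortStay)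
    {G : N → T → ℝ → EReal} (hG : ∀ i j, 𝒩.IsPrimitive i j (G i j)) {z p : N → T → ℝ}
    (hz : ∀ i j, 0 < z i j) (hp : ∀ i j, p i j ∈ Ioc 0 (𝒩.cmax j))
    (hg : ∀ i j, z i j * p i j = 𝒩.g i j (p i j)) :
    𝒩.rate z = p ↔ 𝒩.IsOPFSolution G (fun i j => z i j * p i j) := by
  have hcm : ∀ j, 𝒩.cmax j ∈ Icc 0 (𝒩.cmax j) := fun j => ⟨(h.cmax_pos j).le, le_rfl⟩
  have hpI : ∀ i j, p i j ∈ Icc 0 (𝒩.cmax j) := fun i j => Ioc_subset_Icc_self (hp i j)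
  have hle : ∀ i j, z i j * p i j ≤ 𝒩.g i j (𝒩.cmax j) := fun i j => by
    rw [hg]
    exact (h.strictMonoOn_g i (hs j)).monotoneOn (hpI i j) (hcm j) (hp i j).2
  have hle' : ∀ i j, z i j * p i j ≤ z i j * 𝒩.cmax j := fun i j =>
    mul_le_mul_of_nonneg_left (hp i j).2 (hz i j).le
  have hmarg : ∀ i j, 𝒩.marginal i j (z i j * p i j) = derivE (𝒩.u i j) (p i j) := fun i j => by
    rw [marginal, hg, h.gInv_g hs (hpI i j)]
  -- The two upper bounds bind in the same coordinates, namely where `p = cmax`: the loads are `z p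
  -- = g(p)`, and both expressions are strictly increasing in `p`.
  have hact : ∀ x : N × T, (z x.1 x.2 * p x.1 x.2 < z x.1 x.2 * 𝒩.cmax x.2 ∧
      z x.1 x.2 * p x.1 x.2 < 𝒩.g x.1 x.2 (𝒩.cmax x.2)) ∨
      (z x.1 x.2 * 𝒩.cmax x.2 ≤ z x.1 x.2 * p x.1 x.2 ∧
        𝒩.g x.1 x.2 (𝒩.cmax x.2) ≤ z x.1 x.2 * p x.1 x.2) := fun x => by
    rcases (hp x.1 x.2).2.lt_or_eq with hlt | heq
    · refine Or.inl ⟨mul_lt_mul_of_pos_left hlt (hz _ _), ?_⟩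
      rw [hg]
      exact h.strictMonoOn_g x.1 (hs x.2) (hpI _ _) (hcm _) hlt
    · refine Or.inr ⟨by rw [heq], ?_⟩
      rw [hg, heq]
  rw [h.rate_eq_iff_load hz, h.isOPFSolution_iff_firstOrder hs hG]
  simp only [hmarg]
  constructor
  · rintro ⟨-, hload, hfo⟩
    refine ⟨⟨hload, fun x => hle _ _⟩, fun i j => mul_pos (hz i j) (hp i j).1, fun y hy => ?_⟩
    exact firstOrder_of_box 𝒩.convex_loadSet₂ hload (fun x => hle' x.1 x.2)
      (fun x => (hact x).imp And.left And.right) hfo y hy.1 hy.2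
  · rintro ⟨⟨hload, -⟩, -, hfo⟩
    refine ⟨hp, hload, ?_⟩
    exact firstOrder_of_box 𝒩.convex_loadSet₂ hload (fun x => hle x.1 x.2)
      (fun x => (hact x).imp And.right And.left) fun y hy hyb => hfo y ⟨hy, hyb⟩

/-- Expected sojourn times are positive even at rate `0`, so fixed points are positive; in a
positive state the infinite marginal utility at `0` makes every rate positive, and multiplication of
the equation by the rate is then legitimate. -/
theorem Standing.fixedPoint_spec (h : 𝒩.Standing) {z : N → T → ℝ} (hz : 𝒩.IsFixedPoint z) :
    (∀ i j, 0 < z i j) ∧ (∀ i j, 𝒩.rate z i j ∈ Ioc 0 (𝒩.cmax j)) ∧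
      ∀ i j, z i j * 𝒩.rate z i j = 𝒩.g i j (𝒩.rate z i j) := by
  have hnn := (h.rate_spec hz.1).feasible.nonneg
  have hpos : ∀ i j, 0 < z i j := fun i j => by
    rw [hz.2 i j]
    exact mul_pos (h.gam_pos i j) (h.integral_sojourn_pos j (hnn i j))
  have hp := ((h.rate_eq_iff_load hpos _).1 rfl).1
  refine ⟨hpos, hp, fun i j => ?_⟩
  conv_lhs => rw [hz.2 i j]
  rw [mul_assoc, 𝒩.integral_sojourn_mul j (hp i j).1, g]

theorem Standing.isOPFSolution_of_fixedPoint (h : 𝒩.Standing) (hs : 𝒩.ShortStay)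
    {G : N → T → ℝ → EReal} (hG : ∀ i j, 𝒩.IsPrimitive i j (G i j)) {z : N → T → ℝ}
    (hz : 𝒩.IsFixedPoint z) : 𝒩.IsOPFSolution G (fun i j => z i j * 𝒩.rate z i j) := by
  obtain ⟨hpos, hp, hg⟩ := h.fixedPoint_spec hz
  exact (h.rate_eq_iff_opf hs hG hpos hp hg).1 rfl

/-- The rates `p = g⁻¹(Λ)` and the state `z = Λ / p` satisfy `z p = g(p)` by construction, so
`rate_eq_iff_opf` identifies `p` as the charging rates in state `z`. -/
theorem Standing.isFixedPoint_of_opf (h : 𝒩.Standing) (hs : 𝒩.ShortStay)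
    {G : N → T → ℝ → EReal} (hG : ∀ i j, 𝒩.IsPrimitive i j (G i j)) {Λ : N → T → ℝ}
    (hΛ : 𝒩.IsOPFSolution G Λ) : 𝒩.IsFixedPoint (fun i j => Λ i j / 𝒩.gInv i j (Λ i j)) := by
  obtain ⟨hmem, hpos, -⟩ := (h.isOPFSolution_iff_firstOrder hs hG Λ).1 hΛ
  have hI : ∀ i j, Λ i j ∈ Ioc 0 (𝒩.g i j (𝒩.cmax j)) := fun i j => ⟨hpos i j, hmem.2 (i, j)⟩
  have hp : ∀ i j, 𝒩.gInv i j (Λ i j) ∈ Ioc 0 (𝒩.cmax j) := fun i j =>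
    ⟨h.gInv_pos hs (hI i j), (h.gInv_mem hs (Ioc_subset_Icc_self (hI i j))).2⟩
  have hz : ∀ i j, 0 < Λ i j / 𝒩.gInv i j (Λ i j) := fun i j => div_pos (hpos i j) (hp i j).1
  have hzp : ∀ i j, Λ i j / 𝒩.gInv i j (Λ i j) * 𝒩.gInv i j (Λ i j) = Λ i j := fun i j =>
    div_mul_cancel₀ _ (hp i j).1.ne'
  have hg : ∀ i j, 𝒩.g i j (𝒩.gInv i j (Λ i j)) = Λ i j := fun i j =>
    h.g_gInv hs (Ioc_subset_Icc_self (hI i j))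
  have hrate := (h.rate_eq_iff_opf hs hG hz hp (fun i j => by rw [hzp, hg])).2
    (by simpa only [hzp] using hΛ)
  refine ⟨fun i j => (hz i j).le, fun i j => ?_⟩
  rw [hrate, div_eq_iff (hp i j).1.ne', mul_assoc, 𝒩.integral_sojourn_mul j (hp i j).1]
  exact (hg i j).symm

theorem Standing.fixedPoint_eq (h : 𝒩.Standing) (hs : 𝒩.ShortStay)
    {G : N → T → ℝ → EReal} (hG : ∀ i j, 𝒩.IsPrimitive i j (G i j)) {z Λ : N → T → ℝ}
    (hz : 𝒩.IsFixedPoint z) (hΛ : 𝒩.IsOPFSolution G Λ) (i : N) (j : T) :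
    z i j = Λ i j / 𝒩.gInv i j (Λ i j) := by
  obtain ⟨hpos, hp, hg⟩ := h.fixedPoint_spec hz
  obtain rfl := (h.existsUnique_opf hs hG).unique hΛ (h.isOPFSolution_of_fixedPoint hs hG hz)
  simp only
  rw [hg, h.gInv_g hs (Ioc_subset_Icc_self (hp i j)), ← hg, mul_div_cancel_right₀ _ (hp i j).1.ne']

end Network

/-! ### Long-run averages and convolutions -/

theorem intervalIntegrable_of_bound {f : ℝ → ℝ} {C : ℝ} (hf : Measurable f)
    (hb : ∀ x, |f x| ≤ C) (a b : ℝ) : IntervalIntegrable f volume a b :=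
  (intervalIntegrable_const (c := C)).mono_fun' hf.aestronglyMeasurable
    (Eventually.of_forall hb)

/-- The long-run average of a convergent function is its limit. -/
theorem tendsto_average {f : ℝ → ℝ} {l : ℝ} (hi : ∀ t, 0 ≤ t → IntervalIntegrable f volume 0 t)
    (hf : Tendsto f atTop (𝓝 l)) :
    Tendsto (fun t => (∫ s in (0 : ℝ)..t, f s) / t) atTop (𝓝 l) := by
  rw [Metric.tendsto_atTop]
  intro ε hε
  obtain ⟨t₀, ht₀⟩ := Metric.tendsto_atTop.1 hf (ε / 2) (half_pos hε)
  set τ := max t₀ 0 with hτ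
  have hτ0 : 0 ≤ τ := le_max_right _ _
  set c := |∫ s in (0 : ℝ)..τ, (f s - l)| with hc
  -- After `τ` the integrand is within `ε / 2` of its limit; the second threshold makes the fixed
  -- initial error `c` smaller than `ε / 2 * t`.
  refine ⟨max (τ + 1) (2 * c / ε + 1), fun t ht => ?_⟩
  have h1 : τ + 1 ≤ t := (le_max_left _ _).trans ht
  have h2 : 2 * c / ε + 1 ≤ t := (le_max_right _ _).trans ht
  have ht0 : 0 < t := by linarith
  have hil : ∀ t, 0 ≤ t → IntervalIntegrable (fun s => f s - l) volume 0 t := fun t ht =>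
    (hi t ht).sub intervalIntegrable_const
  have hτt : IntervalIntegrable (fun s => f s - l) volume τ t :=
    (hil τ hτ0).symm.trans (hil t ht0.le)
  have e : (∫ s in (0 : ℝ)..t, f s) / t - l = (∫ s in (0 : ℝ)..t, (f s - l)) / t := by
    rw [intervalIntegral.integral_sub (hi t ht0.le) intervalIntegrable_const,
      intervalIntegral.integral_const]
    simp only [sub_zero, smul_eq_mul]
    field_simp
  rw [Real.dist_eq, e, abs_div, abs_of_pos ht0, div_lt_iff₀ ht0,
    ← intervalIntegral.integral_add_adjacent_intervals (hil τ hτ0) hτt]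
  have h3 : |∫ s in τ..t, (f s - l)| ≤ ε / 2 * |t - τ| := by
    refine intervalIntegral.norm_integral_le_of_norm_le_const (f := fun s => f s - l) fun s hs => ?_
    rw [uIoc_of_le (by linarith)] at hs
    have := ht₀ s ((le_max_left t₀ 0).trans hs.1.le)
    rw [Real.dist_eq] at this
    exact this.le
  rw [abs_of_nonneg (by linarith : 0 ≤ t - τ)] at h3
  refine (abs_add_le _ _).trans_lt ?_
  rw [← hc]
  have h4 : c < ε / 2 * t := by
    have : 2 * c / ε < t := by linarith
    rw [div_lt_iff₀ hε] at this
    linarith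
  nlinarith

/-- The convolution `∫₀ᵗ a(s) h(t - s) ds`. -/
def conv (a h : ℝ → ℝ) (t : ℝ) : ℝ := ∫ s in (0 : ℝ)..t, a s * h (t - s)

section Convolution

variable {a h : ℝ → ℝ} {C : ℝ}

/-- A bounded measurable kernel on a finite square, which licenses the exchange of integrals in
`integral_conv`. -/
theorem integrable_convKernel (ha : Measurable a) (ha1 : ∀ s, |a s| ≤ 1) (hh : Measurable h)
    (hC : ∀ s, |h s| ≤ C) (T : ℝ) :
    Integrable (Function.uncurry fun t s => (Iic t).indicator (fun s => a s * h (t - s)) s)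
      ((volume.restrict (Ioc 0 T)).prod (volume.restrict (Ioc 0 T))) := by
  have hmeas : Measurable
      (Function.uncurry fun t s : ℝ => (Iic t).indicator (fun s => a s * h (t - s)) s) := by
    have : (Function.uncurry fun t s : ℝ => (Iic t).indicator (fun s => a s * h (t - s)) s)
        = {x : ℝ × ℝ | x.2 ≤ x.1}.indicator (fun x => a x.2 * h (x.1 - x.2)) := by
      ext ⟨t, s⟩
      simp [Function.uncurry, indicator]
    rw [this]
    exact Measurable.indicator (by fun_prop) (measurableSet_le measurable_snd measurable_fst)
  refine Integrable.of_bound hmeas.aestronglyMeasurable C (Eventually.of_forall ?_)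
  rintro ⟨t, s⟩
  refine (norm_indicator_le_norm_self (fun s => a s * h (t - s)) s).trans ?_
  rw [norm_mul]
  calc |a s| * |h (t - s)| ≤ 1 * C := mul_le_mul (ha1 s) (hC _) (abs_nonneg _) zero_le_one
    _ = C := one_mul C

theorem integral_convKernel_left {t T : ℝ} (ht : t ∈ Ioc 0 T) :
    ∫ s in Ioc 0 T, (Iic t).indicator (fun s => a s * h (t - s)) s = conv a h t := by
  rw [setIntegral_indicator measurableSet_Iic, conv, intervalIntegral.integral_of_le ht.1.le]
  congr 2
  ext s
  simp only [mem_inter_iff, mem_Ioc, mem_Iic]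
  constructor
  · rintro ⟨⟨h1, _⟩, h2⟩; exact ⟨h1, h2⟩
  · rintro ⟨h1, h2⟩; exact ⟨⟨h1, h2.trans ht.2⟩, h2⟩

theorem integral_convKernel_right {s T : ℝ} (hs : s ∈ Ioc 0 T) :
    ∫ t in Ioc 0 T, (Iic t).indicator (fun s => a s * h (t - s)) s
      = a s * ∫ u in (0 : ℝ)..(T - s), h u := by
  have e : ∀ t, (Iic t).indicator (fun s => a s * h (t - s)) s
      = (Ici s).indicator (fun t => a s * h (t - s)) t := fun t => by
    simp only [indicator, mem_Iic, mem_Ici]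
  simp only [e]
  have hset : Ioc 0 T ∩ Ici s = Icc s T := by
    ext t
    simp only [mem_inter_iff, mem_Ioc, mem_Ici, mem_Icc]
    constructor
    · rintro ⟨⟨_, h1⟩, h2⟩; exact ⟨h2, h1⟩
    · rintro ⟨h1, h2⟩; exact ⟨⟨hs.1.trans_le h1, h2⟩, h1⟩
  rw [setIntegral_indicator measurableSet_Ici, hset, integral_Icc_eq_integral_Ioc,
    ← intervalIntegral.integral_of_le hs.2, intervalIntegral.integral_const_mul,
    intervalIntegral.integral_comp_sub_right (fun u => h u), sub_self]

theorem intervalIntegrable_conv (ha : Measurable a) (ha1 : ∀ s, |a s| ≤ 1) (hh : Measurable h)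
    (hC : ∀ s, |h s| ≤ C) {T : ℝ} (hT : 0 ≤ T) :
    IntervalIntegrable (conv a h) volume 0 T := by
  rw [intervalIntegrable_iff_integrableOn_Ioc_of_le hT]
  refine (integrable_convKernel ha ha1 hh hC T).integral_prod_left.congr ?_
  filter_upwards [ae_restrict_mem measurableSet_Ioc] with t ht
  exact integral_convKernel_left ht

theorem integral_conv (ha : Measurable a) (ha1 : ∀ s, |a s| ≤ 1) (hh : Measurable h)
    (hC : ∀ s, |h s| ≤ C) {T : ℝ} (hT : 0 ≤ T) :
    ∫ t in (0 : ℝ)..T, conv a h t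
      = ∫ s in (0 : ℝ)..T, a s * ∫ u in (0 : ℝ)..(T - s), h u := by
  rw [intervalIntegral.integral_of_le hT, intervalIntegral.integral_of_le hT]
  have := integral_integral_swap (integrable_convKernel ha ha1 hh hC T)
  rw [setIntegral_congr_fun measurableSet_Ioc fun t ht => integral_convKernel_left ht,
    setIntegral_congr_fun measurableSet_Ioc fun s hs => integral_convKernel_right hs] at this
  exact this

/-- The long-run average of a convolution is the product of the long-run average of the first
factor and the integral of the second. -/
theorem tendsto_average_conv_sub (ha : Measurable a) (ha1 : ∀ s, |a s| ≤ 1) (hh : Measurable h)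
    (hC : ∀ s, |h s| ≤ C) (h0 : ∀ s, 0 ≤ h s) (hint : IntegrableOn h (Ioi 0)) :
    Tendsto (fun T => (∫ t in (0 : ℝ)..T, conv a h t) / T
      - (∫ s in (0 : ℝ)..T, a s) / T * ∫ u in Ioi 0, h u) atTop (𝓝 0) := by
  set I := ∫ u in Ioi 0, h u with hI
  -- With `R` the tail integral of `h`, the difference of the two integrals is `-∫ a(s) R(T - s)
  -- ds`. It is bounded by `∫ R`, whose average tends to `0` with `R`. Convergence of the average of
  -- `a` is not required.
  let R : ℝ → ℝ := fun x => I - ∫ u in (0 : ℝ)..x, h u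
  have hhi := intervalIntegrable_of_bound hh hC
  have hRc : Continuous R := continuous_const.sub (intervalIntegral.continuous_primitive hhi 0)
  have hR0 : Tendsto R atTop (𝓝 0) := by
    have := (intervalIntegral_tendsto_integral_Ioi 0 hint tendsto_id).const_sub I
    rwa [← hI, sub_self] at this
  have hRnn : ∀ x, 0 ≤ x → 0 ≤ R x := fun x hx => by
    rw [sub_nonneg, intervalIntegral.integral_of_le hx]
    exact setIntegral_mono_set hint (Eventually.of_forall h0) Ioc_subset_Ioi_self.eventuallyLE
  have havg := tendsto_average (fun t _ => hRc.intervalIntegrable 0 t) hR0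
  refine squeeze_zero_norm' ?_ havg
  filter_upwards [eventually_gt_atTop 0] with T hT
  have hai := intervalIntegrable_of_bound ha ha1
  have hcont : Continuous fun s : ℝ => ∫ u in (0 : ℝ)..(T - s), h u :=
    (intervalIntegral.continuous_primitive hhi 0).comp (by fun_prop)
  have hRT : Continuous fun s : ℝ => R (T - s) := hRc.comp (by fun_prop)
  have e : (∫ t in (0 : ℝ)..T, conv a h t) - (∫ s in (0 : ℝ)..T, a s) * I
      = -∫ s in (0 : ℝ)..T, a s * R (T - s) := by
    rw [integral_conv ha ha1 hh hC hT.le, ← intervalIntegral.integral_mul_const,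
      ← intervalIntegral.integral_sub, ← intervalIntegral.integral_neg]
    · exact intervalIntegral.integral_congr fun s _ => by simp only [R]; ring
    · exact (hai 0 T).mul_continuousOn hcont.continuousOn
    · exact (hai 0 T).mul_const I
  rw [div_mul_eq_mul_div, ← sub_div, e, norm_div, norm_neg, Real.norm_of_nonneg hT.le]
  refine div_le_div_of_nonneg_right ?_ hT.le
  have h1 : ∫ s in (0 : ℝ)..T, R s = ∫ s in (0 : ℝ)..T, R (T - s) := by
    rw [intervalIntegral.integral_comp_sub_left (fun s => R s)]
    simp
  rw [h1]
  refine intervalIntegral.norm_integral_le_of_norm_le hT.le (Eventually.of_forall fun s hs => ?_)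
    (hRT.intervalIntegrable 0 T)
  have h2 := hRnn (T - s) (by linarith [hs.2])
  rw [norm_mul, Real.norm_of_nonneg h2]
  exact mul_le_of_le_one_left h2 (ha1 s)

end Convolution

/-! ### Convolution with a survival function -/

section Survival

variable {a Φ : ℝ → ℝ} {C : ℝ}

theorem intervalIntegrable_mul_comp_sub (ha : Measurable a) (ha1 : ∀ s, a s ∈ Icc (0 : ℝ) 1)
    (hΦ : Antitone Φ) (hΦb : ∀ u, Φ u ∈ Icc 0 C) (t x y : ℝ) :
    IntervalIntegrable (fun s => a s * Φ (t - s)) volume x y := by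
  have hm : Measurable fun s => a s * Φ (t - s) := ha.mul (hΦ.measurable.comp (by fun_prop))
  refine intervalIntegrable_of_bound (C := 1 * C) hm (fun s => ?_) x y
  rw [abs_mul, abs_of_nonneg (ha1 s).1, abs_of_nonneg (hΦb _).1]
  exact mul_le_mul (ha1 s).2 (hΦb _).2 (hΦb _).1 zero_le_one

/-- The change of the population is a balance: arrivals after `t'` still present at `t`, minus
earlier arrivals that leave between `t'` and `t`. -/
theorem conv_sub_conv (ha : Measurable a) (ha1 : ∀ s, a s ∈ Icc (0 : ℝ) 1)
    (hΦ : Antitone Φ) (hΦb : ∀ u, Φ u ∈ Icc 0 C) (t' t : ℝ) :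
    conv a Φ t - conv a Φ t' = (∫ s in t'..t, a s * Φ (t - s))
      - ∫ s in (0 : ℝ)..t', a s * (Φ (t' - s) - Φ (t - s)) := by
  have hi := intervalIntegrable_mul_comp_sub ha ha1 hΦ hΦb
  simp only [mul_sub]
  rw [conv, conv, intervalIntegral.integral_sub (hi t' 0 t') (hi t 0 t'),
    ← intervalIntegral.integral_add_adjacent_intervals (hi t 0 t') (hi t t' t)]
  ring

theorem departures_nonneg (ha1 : ∀ s, a s ∈ Icc (0 : ℝ) 1) (hΦ : Antitone Φ) {t' t : ℝ}
    (ht' : 0 ≤ t') (ht : t' ≤ t) :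
    0 ≤ ∫ s in (0 : ℝ)..t', a s * (Φ (t' - s) - Φ (t - s)) :=
  intervalIntegral.integral_nonneg ht' fun s _ =>
    mul_nonneg (ha1 s).1 (sub_nonneg.2 (hΦ (by linarith)))

/-- Departures are greatest when all past arrivals were admitted. In that case they amount to `∫ Φ`
over `[0, t - t']` minus `∫ Φ` over `[t', t]`. -/
theorem departures_le (ha : Measurable a) (ha1 : ∀ s, a s ∈ Icc (0 : ℝ) 1)
    (hΦ : Antitone Φ) (hΦb : ∀ u, Φ u ∈ Icc 0 C) {t' t : ℝ} (ht' : 0 ≤ t') (ht : t' ≤ t) :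
    ∫ s in (0 : ℝ)..t', a s * (Φ (t' - s) - Φ (t - s)) ≤ ∫ u in (0 : ℝ)..(t - t'), Φ u := by
  have hi := intervalIntegrable_mul_comp_sub ha ha1 hΦ hΦb
  have hi1 : ∀ t x y, IntervalIntegrable (fun s => Φ (t - s)) volume x y := fun t x y => by
    simpa using intervalIntegrable_mul_comp_sub (a := fun _ => 1) measurable_const
      (fun _ => ⟨zero_le_one, le_rfl⟩) hΦ hΦb t x y
  have hΦi : ∀ x y, IntervalIntegrable Φ volume x y := fun x y =>
    intervalIntegrable_of_bound (C := C) hΦ.measurable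
      (fun u => by rw [abs_of_nonneg (hΦb u).1]; exact (hΦb u).2) x y
  have h1 : ∫ s in (0 : ℝ)..t', a s * (Φ (t' - s) - Φ (t - s))
      ≤ ∫ s in (0 : ℝ)..t', (Φ (t' - s) - Φ (t - s)) := by
    refine intervalIntegral.integral_mono_on ht' ?_ ((hi1 t' 0 t').sub (hi1 t 0 t')) fun s _ => ?_
    · simp only [mul_sub]
      exact (hi t' 0 t').sub (hi t 0 t')
    · exact mul_le_of_le_one_left (sub_nonneg.2 (hΦ (by linarith))) (ha1 s).2
  refine h1.trans ?_
  rw [intervalIntegral.integral_sub (hi1 t' 0 t') (hi1 t 0 t'),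
    intervalIntegral.integral_comp_sub_left (fun s => Φ s),
    intervalIntegral.integral_comp_sub_left (fun s => Φ s), sub_self, sub_zero, sub_zero]
  have h2 := intervalIntegral.integral_add_adjacent_intervals (hΦi 0 t') (hΦi t' t)
  have h3 := intervalIntegral.integral_add_adjacent_intervals (hΦi 0 (t - t')) (hΦi (t - t') t)
  have h4 : 0 ≤ ∫ u in t'..t, Φ u := intervalIntegral.integral_nonneg ht fun u _ => (hΦb u).1
  linarith

theorem conv_nonneg (ha1 : ∀ s, a s ∈ Icc (0 : ℝ) 1) (hΦb : ∀ u, Φ u ∈ Icc 0 C) {t : ℝ}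
    (ht : 0 ≤ t) : 0 ≤ conv a Φ t :=
  intervalIntegral.integral_nonneg ht fun s _ => mul_nonneg (ha1 s).1 (hΦb _).1

/-- Without arrivals the population does not grow. -/
theorem conv_le_of_off (ha : Measurable a) (ha1 : ∀ s, a s ∈ Icc (0 : ℝ) 1)
    (hΦ : Antitone Φ) (hΦb : ∀ u, Φ u ∈ Icc 0 C) {t' t : ℝ} (ht' : 0 ≤ t') (ht : t' ≤ t)
    (hoff : ∀ s ∈ Ioc t' t, a s = 0) : conv a Φ t ≤ conv a Φ t' := by
  have h1 := conv_sub_conv ha ha1 hΦ hΦb t' t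
  have h2 := departures_nonneg ha1 hΦ ht' ht
  have h3 : ∫ s in t'..t, a s * Φ (t - s) = 0 := by
    rw [intervalIntegral.integral_of_le ht, setIntegral_congr_fun measurableSet_Ioc
      (g := fun _ => (0 : ℝ)) fun s hs => by simp [hoff s hs]]
    simp
  linarith

/-- With full arrivals the population does not decrease. -/
theorem conv_le_of_on (ha : Measurable a) (ha1 : ∀ s, a s ∈ Icc (0 : ℝ) 1)
    (hΦ : Antitone Φ) (hΦb : ∀ u, Φ u ∈ Icc 0 C) {t' t : ℝ} (ht' : 0 ≤ t') (ht : t' ≤ t)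
    (hon : ∀ s ∈ Ioc t' t, a s = 1) : conv a Φ t' ≤ conv a Φ t := by
  have h1 := conv_sub_conv ha ha1 hΦ hΦb t' t
  have h2 := departures_le ha ha1 hΦ hΦb ht' ht
  have h3 : ∫ s in t'..t, a s * Φ (t - s) = ∫ u in (0 : ℝ)..(t - t'), Φ u := by
    rw [intervalIntegral.integral_of_le ht, setIntegral_congr_fun measurableSet_Ioc
      (g := fun s => Φ (t - s)) fun s hs => by simp [hon s hs],
      ← intervalIntegral.integral_of_le ht,
      intervalIntegral.integral_comp_sub_left (fun s => Φ s), sub_self]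
  linarith

theorem abs_conv_sub_conv_le (ha : Measurable a) (ha1 : ∀ s, a s ∈ Icc (0 : ℝ) 1)
    (hΦ : Antitone Φ) (hΦb : ∀ u, Φ u ∈ Icc 0 C) {t' t : ℝ} (ht' : 0 ≤ t') (ht : t' ≤ t) :
    |conv a Φ t - conv a Φ t'| ≤ C * (t - t') := by
  have h1 := conv_sub_conv ha ha1 hΦ hΦb t' t
  have h2 := departures_le ha ha1 hΦ hΦb ht' ht
  have h2' := departures_nonneg ha1 hΦ ht' ht
  have hδ : 0 ≤ t - t' := sub_nonneg.2 ht
  have h3 : ∫ u in (0 : ℝ)..(t - t'), Φ u ≤ C * (t - t') := by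
    have := intervalIntegral.integral_mono_on (f := Φ) (g := fun _ => C) hδ
      (intervalIntegrable_of_bound (C := C) hΦ.measurable
        (fun u => by rw [abs_of_nonneg (hΦb u).1]; exact (hΦb u).2) _ _)
      intervalIntegrable_const fun u _ => (hΦb u).2
    rw [intervalIntegral.integral_const, smul_eq_mul, sub_zero] at this
    linarith
  have h4 : ∫ s in t'..t, a s * Φ (t - s) ≤ C * (t - t') := by
    have := intervalIntegral.integral_mono_on (g := fun _ => C) ht
      (intervalIntegrable_mul_comp_sub ha ha1 hΦ hΦb t t' t)
      intervalIntegrable_const fun u _ =>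
        (mul_le_of_le_one_left (hΦb _).1 (ha1 u).2).trans (hΦb (t - u)).2
    rw [intervalIntegral.integral_const, smul_eq_mul] at this
    linarith
  have h5 : 0 ≤ ∫ s in t'..t, a s * Φ (t - s) :=
    intervalIntegral.integral_nonneg ht fun s _ => mul_nonneg (ha1 s).1 (hΦb _).1
  rw [abs_le]
  constructor <;> linarith

theorem continuousWithinAt_conv (ha : Measurable a) (ha1 : ∀ s, a s ∈ Icc (0 : ℝ) 1)
    (hΦ : Antitone Φ) (hΦb : ∀ u, Φ u ∈ Icc 0 C) {t : ℝ} (ht : 0 < t) :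
    ContinuousWithinAt (conv a Φ) (Iic t) t := by
  rw [ContinuousWithinAt, tendsto_iff_norm_sub_tendsto_zero]
  have hlim : Tendsto (fun s => C * (t - s)) (𝓝[≤] t) (𝓝 0) := by
    have : Tendsto (fun s => C * (t - s)) (𝓝 t) (𝓝 (C * (t - t))) :=
      Continuous.tendsto (by fun_prop) _
    rw [sub_self, mul_zero] at this
    exact this.mono_left nhdsWithin_le_nhds
  refine squeeze_zero' (Eventually.of_forall fun _ => norm_nonneg _) ?_ hlim
  filter_upwards [nhdsWithin_le_nhds (lt_mem_nhds ht), self_mem_nhdsWithin] with s hs hst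
  rw [Real.norm_eq_abs, abs_sub_comm]
  exact abs_conv_sub_conv_le ha ha1 hΦ hΦb hs.le hst

end Survival

/-- Used for last-time arguments: the supremum is approached from within `A`, hence from the left,
and left continuity is all that the population offers. -/
theorem mem_of_isLUB_of_le {q : ℝ → ℝ} {A : Set ℝ} {x K : ℝ} (hx : IsLUB A x) (hA : A.Nonempty)
    (hq : ContinuousWithinAt q (Iic x) x) (h : ∀ s ∈ A, q s ≤ K) : q x ≤ K :=
  le_of_tendsto_of_frequently hq ((hx.frequently_mem hA).mono h)

/-- A loss system with capacity `K`, fed at unit rate whenever its population `q` is below `K`.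
Here `S` is the part of the population that was there initially, and `Φ` is the rate-weighted
survival function of the arrivals. The long-run proportion of time during which arrivals are
admitted is `min 1 (K / ∫ Φ)`. -/
theorem tendsto_average_admission {a q S Φ : ℝ → ℝ} {C K : ℝ} (hK : 0 < K) (ha : Measurable a)
    (hΦ : Antitone Φ) (hΦb : ∀ u, Φ u ∈ Icc 0 C) (hΦi : IntegrableOn Φ (Ioi 0))
    (hρ : 0 < ∫ u in Ioi 0, Φ u) (hS : Antitone S) (hS0 : ∀ t, 0 ≤ S t)
    (hSlim : Tendsto S atTop (𝓝 0)) (hSc : ∀ t, ContinuousWithinAt S (Iic t) t)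
    (hq : ∀ t, 0 ≤ t → q t = S t + conv a Φ t) (hon : ∀ t, q t < K → a t = 1)
    (hoff : ∀ t, K ≤ q t → a t = 0) :
    Tendsto (fun t => (∫ s in (0 : ℝ)..t, a s) / t) atTop (𝓝 (min 1 (K / ∫ u in Ioi 0, Φ u))) := by
  set ρ := ∫ u in Ioi 0, Φ u with hρdef
  have ha1 : ∀ s, a s ∈ Icc (0 : ℝ) 1 := fun s => by
    rcases lt_or_ge (q s) K with h | h
    · simp [hon s h]
    · simp [hoff s h]
  have ha1' : ∀ s, |a s| ≤ 1 := fun s => by rw [abs_of_nonneg (ha1 s).1]; exact (ha1 s).2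
  have hΦC : ∀ s, |Φ s| ≤ C := fun s => by rw [abs_of_nonneg (hΦb s).1]; exact (hΦb s).2
  have hai := intervalIntegrable_of_bound ha ha1'
  have hqc : ∀ t, 0 < t → ContinuousWithinAt q (Iic t) t := fun t ht => by
    refine ((hSc t).add (continuousWithinAt_conv ha ha1 hΦ hΦb ht)).congr_of_eventuallyEq ?_
      (hq t ht.le)
    filter_upwards [nhdsWithin_le_nhds (lt_mem_nhds ht)] with s hs using hq s hs.le
  have hconv0 := fun {t : ℝ} => conv_nonneg (t := t) ha1 hΦb
  -- Were the population above `K` at all positive times, nothing would be admitted and only the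
  -- initial part, which dies out, would remain.
  have hstart : ∃ t₀, 0 < t₀ ∧ q t₀ ≤ K := by
    by_contra! hcon
    obtain ⟨t, ht, ht0⟩ := ((hSlim.eventually (gt_mem_nhds hK)).and (eventually_gt_atTop 0)).exists
    have h1 := conv_le_of_off ha ha1 hΦ hΦb le_rfl ht0.le fun s hs => hoff s (hcon s hs.1).le
    have h2 : conv a Φ 0 = 0 := by simp [conv]
    have h3 := hcon t ht0
    rw [hq t ht0.le] at h3
    linarith
  obtain ⟨t₀, ht₀, hqt₀⟩ := hstart
  -- The lot cannot be overfilled again: after the last time `τ` with `q ≤ K` there are no arrivals,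
  -- so the population does not grow.
  have hle : ∀ t, t₀ ≤ t → q t ≤ K := by
    intro t ht
    by_contra! hcon
    let A := {s | s ∈ Icc t₀ t ∧ q s ≤ K}
    have hA : A.Nonempty := ⟨t₀, ⟨le_rfl, ht⟩, hqt₀⟩
    have hbdd : BddAbove A := ⟨t, fun s hs => hs.1.2⟩
    have hlub := isLUB_csSup hA hbdd
    set τ := sSup A with hτ
    have h1 : t₀ ≤ τ := hlub.1 ⟨⟨le_rfl, ht⟩, hqt₀⟩
    have h2 : τ ≤ t := hlub.2 fun s hs => hs.1.2
    have hτ0 : 0 < τ := ht₀.trans_le h1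
    have h3 : q τ ≤ K := mem_of_isLUB_of_le hlub hA (hqc τ hτ0) fun s hs => hs.2
    have h4 := conv_le_of_off ha ha1 hΦ hΦb hτ0.le h2 fun s hs => hoff s (by
      by_contra! hs'
      exact absurd (hlub.1 ⟨⟨h1.trans hs.1.le, hs.2⟩, hs'.le⟩) hs.1.not_ge)
    rw [hq t (hτ0.le.trans h2)] at hcon
    rw [hq τ hτ0.le] at h3
    linarith [hS h2]
  have hrle : ∀ t, t₀ ≤ t → conv a Φ t ≤ K := fun t ht => by
    have := hle t ht
    rw [hq t (ht₀.le.trans ht)] at this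
    linarith [hS0 t]
  -- Either the lot is eventually never full, and then admission is permanent and `ρ ≤ K`, or it is
  -- full at arbitrarily late times.
  by_cases hcase : ∃ t₁, ∀ t, t₁ ≤ t → q t < K
  · obtain ⟨t₁, ht₁⟩ := hcase
    have hlim : Tendsto (fun t => ∫ u in (0 : ℝ)..(t - max t₁ 0), Φ u) atTop (𝓝 ρ) :=
      intervalIntegral_tendsto_integral_Ioi 0 hΦi (tendsto_atTop_add_const_right _ _ tendsto_id)
    have hρK : ρ ≤ K := by
      refine le_of_tendsto hlim ?_
      filter_upwards [eventually_ge_atTop (max t₁ 0), eventually_ge_atTop t₀] with t ht ht'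
      refine le_trans ?_ (hrle t ht')
      set τ := max t₁ 0
      have hτ0 : 0 ≤ τ := le_max_right _ _
      have hi := intervalIntegrable_mul_comp_sub ha ha1 hΦ hΦb t
      rw [conv, ← intervalIntegral.integral_add_adjacent_intervals (hi 0 τ) (hi τ t)]
      have h1 : 0 ≤ ∫ s in (0 : ℝ)..τ, a s * Φ (t - s) :=
        intervalIntegral.integral_nonneg hτ0 fun s _ => mul_nonneg (ha1 s).1 (hΦb _).1
      have h2 : ∫ s in τ..t, a s * Φ (t - s) = ∫ u in (0 : ℝ)..(t - τ), Φ u := by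
        rw [intervalIntegral.integral_of_le ht, setIntegral_congr_fun measurableSet_Ioc
          (g := fun s => Φ (t - s)) fun s hs => by
            simp [hon s (ht₁ s ((le_max_left _ _).trans hs.1.le))],
          ← intervalIntegral.integral_of_le ht,
          intervalIntegral.integral_comp_sub_left (fun s => Φ s), sub_self]
      linarith
    rw [min_eq_left ((one_le_div hρ).2 hρK)]
    refine tendsto_average (fun t _ => hai 0 t) (tendsto_const_nhds.congr' ?_)
    filter_upwards [eventually_ge_atTop t₁] with t ht using (hon t (ht₁ t ht)).symm
  · push Not at hcase
    -- After the last time `σ ≤ t` with `q ≥ K` all arrivals enter, so the admitted population does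
    -- not decrease; at `σ` it is at least `K - S σ`, and `S` vanishes in the limit.
    have hrlim : Tendsto (conv a Φ) atTop (𝓝 K) := by
      refine tendsto_order.2 ⟨fun b hb => ?_, fun b hb => ?_⟩
      · obtain ⟨t₂, ht₂⟩ := eventually_atTop.1
          (hSlim.eventually (gt_mem_nhds (sub_pos.2 hb)))
        obtain ⟨τ, hτ, hqτ⟩ := hcase (max t₀ t₂)
        filter_upwards [eventually_ge_atTop τ] with t ht
        have hτ0 : 0 < τ := ht₀.trans_le ((le_max_left _ _).trans hτ)
        let A := {s | s ∈ Icc τ t ∧ K ≤ q s}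
        have hA : A.Nonempty := ⟨τ, ⟨le_rfl, ht⟩, hqτ⟩
        have hbdd : BddAbove A := ⟨t, fun s hs => hs.1.2⟩
        have hlub := isLUB_csSup hA hbdd
        set σ := sSup A with hσ
        have h1 : τ ≤ σ := hlub.1 ⟨⟨le_rfl, ht⟩, hqτ⟩
        have h2 : σ ≤ t := hlub.2 fun s hs => hs.1.2
        have hσ0 : 0 < σ := hτ0.trans_le h1
        have h3 : K ≤ q σ := neg_le_neg_iff.1 <| mem_of_isLUB_of_le (q := fun s => -q s) hlub hA
          (hqc σ hσ0).neg fun s hs => neg_le_neg hs.2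
        have h4 := conv_le_of_on ha ha1 hΦ hΦb hσ0.le h2 fun s hs => hon s (by
          by_contra! hs'
          exact absurd (hlub.1 ⟨⟨h1.trans hs.1.le, hs.2⟩, hs'⟩) hs.1.not_ge)
        rw [hq σ hσ0.le] at h3
        have h5 := ht₂ σ ((le_max_right _ _).trans (hτ.trans h1))
        linarith
      · filter_upwards [eventually_ge_atTop t₀] with t ht using (hrle t ht).trans_lt hb
    have havg := tendsto_average
      (fun t ht => intervalIntegrable_conv ha ha1' hΦ.measurable hΦC ht) hrlim
    have hsub := tendsto_average_conv_sub ha ha1' hΦ.measurable hΦC (fun s => (hΦb s).1) hΦi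
    -- Little's law: the average admitted population `K` equals the admitted fraction times `ρ`.
    have hlim : Tendsto (fun t => (∫ s in (0 : ℝ)..t, a s) / t) atTop (𝓝 (K / ρ)) := by
      have := (havg.sub hsub).div_const ρ
      rw [sub_zero] at this
      refine this.congr fun t => ?_
      rw [← hρdef]
      field_simp
      ring
    have hle1 : K / ρ ≤ 1 := by
      refine le_of_tendsto hlim ?_
      filter_upwards [eventually_gt_atTop 0] with t ht
      rw [div_le_one ht]
      have := intervalIntegral.integral_mono_on (g := fun _ => (1 : ℝ)) ht.le (hai 0 t)
        intervalIntegrable_const fun s _ => (ha1 s).2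
      simpa using this
    rwa [min_eq_right hle1]

/-! ### Survival functions -/

section SurvivalFunction

open Network (sojourn)

variable {μ : Measure (ℝ × ℝ)} [IsProbabilityMeasure μ]

/-- Reflection turns the left-continuous survival function into a right-continuous distribution
function, from which left continuity and the limit at infinity are read off. -/
theorem survival_eq_cdf (t : ℝ) :
    μ.real {x | t ≤ x.2} = ProbabilityTheory.cdf (μ.map fun x => -x.2) (-t) := by
  have hm : Measurable fun x : ℝ × ℝ => -x.2 := by fun_prop
  have := Measure.isProbabilityMeasure_map (μ := μ) hm.aemeasurable
  rw [ProbabilityTheory.cdf_eq_real, map_measureReal_apply hm measurableSet_Iic]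
  congr 1
  ext x
  simp

theorem survival_antitone : Antitone fun t : ℝ => μ.real {x : ℝ × ℝ | t ≤ x.2} :=
  fun _ _ hst => measureReal_mono fun _ hx => le_trans hst hx

theorem survival_tendsto_zero :
    Tendsto (fun t : ℝ => μ.real {x : ℝ × ℝ | t ≤ x.2}) atTop (𝓝 0) := by
  simp only [survival_eq_cdf]
  exact (ProbabilityTheory.tendsto_cdf_atBot _).comp tendsto_neg_atTop_atBot

theorem survival_leftContinuous (t : ℝ) :
    ContinuousWithinAt (fun t : ℝ => μ.real {x : ℝ × ℝ | t ≤ x.2}) (Iic t) t := by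
  simp only [survival_eq_cdf]
  have h := (ProbabilityTheory.cdf (μ.map fun x : ℝ × ℝ => -x.2)).right_continuous (-t)
  exact h.comp (continuous_neg.continuousWithinAt) fun s hs =>
    mem_Ici.2 (neg_le_neg (mem_Iic.1 hs))

theorem survival_integrable (hD : Integrable (fun x : ℝ × ℝ => x.2) μ)
    (hpos : ∀ᵐ x ∂μ, 0 < x.2) :
    IntegrableOn (fun t : ℝ => μ.real {x : ℝ × ℝ | t ≤ x.2}) (Ioi 0) ∧
      ∫ t in Ioi (0 : ℝ), μ.real {x : ℝ × ℝ | t ≤ x.2} = ∫ x, x.2 ∂μ := by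
  have h0 : 0 ≤ᵐ[μ] fun x => x.2 := hpos.mono fun x hx => hx.le
  have e := hD.integral_eq_integral_meas_le h0
  refine ⟨?_, e.symm⟩
  -- The Bochner integral of a non-integrable function is `0` by convention; the tail formula would
  -- then give mean `0` to an almost surely positive variable.
  by_contra hni
  have h1 := integral_undef hni
  have h2 : ∫ x, x.2 ∂μ = 0 := e.trans h1
  obtain ⟨x, hx, hx'⟩ := (((integral_eq_zero_iff_of_nonneg_ae h0 hD).1 h2).and hpos).exists
  exact hx'.ne' hx

theorem measurable_sojournSurvival (p : ℝ) :
    Measurable fun t : ℝ => μ.real {x : ℝ × ℝ | t * p < x.1 ∧ t ≤ x.2} := by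
  have hs : MeasurableSet {y : ℝ × ℝ × ℝ | y.1 * p < y.2.1 ∧ y.1 ≤ y.2.2} :=
    MeasurableSet.inter
      (measurableSet_lt (f := fun y : ℝ × ℝ × ℝ => y.1 * p) (g := fun y => y.2.1)
        (by fun_prop) (by fun_prop))
      (measurableSet_le (f := fun y : ℝ × ℝ × ℝ => y.1) (g := fun y => y.2.2)
        (by fun_prop) (by fun_prop))
  exact (measurable_measure_prodMk_left hs).ennreal_toReal

/-- The tail formula for the expected sojourn time. -/
theorem integral_sojournSurvival {p : ℝ} (hp : 0 ≤ p)
    (hD : Integrable (fun x : ℝ × ℝ => sojourn x.1 x.2 p) μ)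
    (hBpos : ∀ᵐ x ∂μ, 0 < x.1) (hDpos : ∀ᵐ x ∂μ, 0 < x.2)
    (hi : IntegrableOn (fun t : ℝ => μ.real {x : ℝ × ℝ | t ≤ x.2}) (Ioi 0)) :
    ∫ t in Ioi (0 : ℝ), μ.real {x : ℝ × ℝ | t * p < x.1 ∧ t ≤ x.2}
      = ∫ x, sojourn x.1 x.2 p ∂μ := by
  have h0 : 0 ≤ᵐ[μ] fun x => sojourn x.1 x.2 p := by
    filter_upwards [hBpos, hDpos] with x hB hD
    unfold sojourn
    split_ifs
    · exact hD.le
    · exact le_min hD.le (div_nonneg hB.le hp)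
  have hsd : ∀ x : ℝ × ℝ, sojourn x.1 x.2 p ≤ x.2 := fun x => by
    unfold sojourn
    split_ifs
    exacts [le_rfl, min_le_left _ _]
  have hint : ∀ f : ℝ → ℝ, Measurable f → (∀ t, 0 ≤ f t) →
      (∀ t, f t ≤ μ.real {x : ℝ × ℝ | t ≤ x.2}) → IntegrableOn f (Ioi 0) := fun f hf hf0 hfle =>
    hi.mono' hf.aestronglyMeasurable (Eventually.of_forall fun t => by
      rw [Real.norm_of_nonneg (hf0 t)]; exact hfle t)
  have hmid := hint _ (measurable_sojournSurvival (μ := μ) p) (fun t => measureReal_nonneg)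
    fun t => measureReal_mono fun x hx => hx.2
  have hle := hint (fun t => μ.real {x : ℝ × ℝ | t ≤ sojourn x.1 x.2 p})
    (Antitone.measurable fun s t hst => measureReal_mono fun x hx => le_trans hst hx)
    (fun t => measureReal_nonneg) fun t => measureReal_mono fun x hx => le_trans hx (hsd x)
  have hlt := hint (fun t => μ.real {x : ℝ × ℝ | t < sojourn x.1 x.2 p})
    (Antitone.measurable fun s t hst => measureReal_mono fun x hx => lt_of_le_of_lt hst hx)
    (fun t => measureReal_nonneg)
    fun t => measureReal_mono fun x hx => (le_of_lt hx).trans (hsd x)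
  -- The event has one strict and one weak inequality, so almost surely it lies between `{t <
  -- sojourn}` and `{t ≤ sojourn}`, and both tails integrate to the mean. Positivity of `B` settles
  -- the case `p = 0`.
  refine le_antisymm ?_ ?_
  · rw [hD.integral_eq_integral_meas_le h0]
    refine setIntegral_mono_on hmid hle measurableSet_Ioi fun t ht => measureReal_mono ?_
    rintro x ⟨h1, h2⟩
    change t ≤ sojourn x.1 x.2 p
    unfold sojourn
    split_ifs with hp0
    · exact h2
    · exact le_min h2 ((le_div_iff₀ (lt_of_le_of_ne hp (Ne.symm hp0))).2 h1.le)
  · rw [hD.integral_eq_integral_meas_lt h0]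
    refine setIntegral_mono_ae_restrict hlt hmid (Eventually.of_forall fun t => ?_)
    refine ENNReal.toReal_mono (measure_ne_top _ _) (measure_mono_ae ?_)
    filter_upwards [hBpos] with x hB hx
    have hx : t < sojourn x.1 x.2 p := hx
    refine ⟨?_, hx.le.trans (hsd x)⟩
    unfold sojourn at hx
    split_ifs at hx with hp0
    · simpa [hp0] using hB
    · exact (lt_div_iff₀ (lt_of_le_of_ne hp (Ne.symm hp0))).1 (lt_min_iff.1 hx).2

end SurvivalFunction

/-! ### Invariant points of the fluid model. -/

namespace Network

variable {N T : Type*} [Fintype N] [Fintype T] {𝒩 : Network N T}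

/-- The long-run proportion of time during which EVs are admitted at a node. -/
theorem IsFluidSolution.tendsto_average_admission (h : 𝒩.Standing)
    {F₀ : N → T → Measure (ℝ × ℝ)} [∀ i j, IsProbabilityMeasure (F₀ i j)] {q z : ℝ → N → T → ℝ}
    (hsol : 𝒩.IsFluidSolution F₀ q z) (i : N) (j : T) {a : ℝ → ℝ}
    (ha : ∀ t, a t = if total q i t < 𝒩.K i then 1 else 0) :
    Measurable a ∧ Tendsto (fun t => (∫ s in (0 : ℝ)..t, a s) / t) atTop
      (𝓝 (min 1 (𝒩.K i / ∑ j', 𝒩.lam i j' * 𝒩.meanD j'))) := by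
  have hp := h.prob
  have ham : Measurable a := by
    have : a = fun t => if total q i t < 𝒩.K i then 1 else 0 := funext ha
    rw [this]
    have hm : Measurable fun t => total q i t :=
      Finset.measurable_sum _ fun j _ => hsol.q_measurable i j
    exact Measurable.ite (measurableSet_lt hm measurable_const) measurable_const measurable_const
  refine ⟨ham, ?_⟩
  have ha1 : ∀ s, a s ∈ Icc (0 : ℝ) 1 := fun s => by rw [ha]; split_ifs <;> simp
  -- All types at a node share one admission indicator, so summing over types yields a single loss
  -- system with survival function `Φ` weighted by the arrival rates.
  let Φj : T → ℝ → ℝ := fun j u => (𝒩.F j).real {x | u ≤ x.2}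
  let Φ : ℝ → ℝ := fun u => ∑ j, 𝒩.lam i j * Φj j u
  let S : ℝ → ℝ := fun t => ∑ j, q 0 i j * (F₀ i j).real {x | t ≤ x.2}
  have hlam : ∀ j, 0 ≤ 𝒩.lam i j := fun j => (h.lam_pos i j).le
  have hΦint : ∀ j, IntegrableOn (fun u => 𝒩.lam i j * Φj j u) (Ioi 0) := fun j =>
    (survival_integrable (h.D_integrable j) (h.D_pos j)).1.const_mul _
  have hρ : ∫ u in Ioi 0, Φ u = ∑ j', 𝒩.lam i j' * 𝒩.meanD j' := by
    rw [integral_finsetSum _ fun j _ => hΦint j]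
    refine Finset.sum_congr rfl fun j _ => ?_
    rw [integral_const_mul, (survival_integrable (h.D_integrable j) (h.D_pos j)).2, meanD]
  have hΦj1 : ∀ j u, Φj j u ∈ Icc (0 : ℝ) 1 := fun j u => ⟨measureReal_nonneg, measureReal_le_one⟩
  rw [← hρ]
  refine EVCharging.tendsto_average_admission (S := S) (q := total q i) (C := ∑ j, 𝒩.lam i j)
    (h.K_pos i) ham ?_ ?_ ?_ ?_ ?_ ?_ ?_ ?_ ?_ ?_ ?_
  · exact fun s t hst => Finset.sum_le_sum fun j _ =>
      mul_le_mul_of_nonneg_left (survival_antitone hst) (hlam j)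
  · exact fun u => ⟨Finset.sum_nonneg fun j _ => mul_nonneg (hlam j) (hΦj1 j u).1,
      Finset.sum_le_sum fun j _ => mul_le_of_le_one_right (hlam j) (hΦj1 j u).2⟩
  · exact integrable_finsetSum _ fun j _ => hΦint j
  · rw [hρ]
    exact h.sum_lam_meanD_pos i j
  · exact fun s t hst => Finset.sum_le_sum fun j _ =>
      mul_le_mul_of_nonneg_left (survival_antitone hst) (hsol.q_init i j)
  · exact fun t => Finset.sum_nonneg fun j _ => mul_nonneg (hsol.q_init i j) measureReal_nonneg
  · have : Tendsto S atTop (𝓝 (∑ j, q 0 i j * 0)) :=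
      tendsto_finsetSum _ fun j _ => survival_tendsto_zero.const_mul _
    simpa using this
  · intro t
    exact tendsto_finsetSum _ fun j _ => (survival_leftContinuous t).const_mul _
  · intro t ht
    have hconv : conv a Φ t = ∑ j, ∫ s in (0 : ℝ)..t, 𝒩.admission q i j s * Φj j (t - s) := by
      rw [conv, ← intervalIntegral.integral_finsetSum]
      · refine intervalIntegral.integral_congr fun s _ => ?_
        simp only [Φ, Finset.mul_sum, ha, admission]
        refine Finset.sum_congr rfl fun j _ => ?_
        split_ifs <;> ring
      · intro j _
        have := (intervalIntegrable_mul_comp_sub (Φ := Φj j) ham ha1 survival_antitone (hΦj1 j)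
          t 0 t).const_mul (𝒩.lam i j)
        refine this.congr fun s _ => ?_
        simp only [ha, admission]
        split_ifs <;> ring
    rw [hconv, ← Finset.sum_add_distrib, total]
    exact Finset.sum_congr rfl fun j _ => hsol.q_eq t ht i j
  · intro t ht
    rw [ha, if_pos ht]
  · intro t ht
    rw [ha, if_neg ht.not_gt]

/-- In a constant state `conv a η` converges to `z / lam`, since the initial EVs disappear. Its
long-run average must also equal the admitted fraction times the expected sojourn time, and
uniqueness of limits gives the equation. -/
theorem Standing.isFixedPoint_of_isInvariantPoint (h : 𝒩.Standing) {z : N → T → ℝ}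
    (hz : 𝒩.IsInvariantPoint z) : 𝒩.IsFixedPoint z := by
  classical
  obtain ⟨F₀, q, hF₀, hsol⟩ := hz
  have hz0 : ∀ i j, 0 ≤ z i j := hsol.nonneg 0 le_rfl
  refine ⟨hz0, fun i j => ?_⟩
  have hpr := h.prob
  let a : ℝ → ℝ := fun t => if total q i t < 𝒩.K i then 1 else 0
  obtain ⟨ham, havg⟩ := hsol.tendsto_average_admission h i j (a := a) fun t => rfl
  have ha1 : ∀ s, |a s| ≤ 1 := fun s => by simp only [a]; split_ifs <;> simp
  set p := 𝒩.rate z i j with hp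
  have hp0 : 0 ≤ p := (h.rate_spec hz0).feasible.nonneg i j
  let η : ℝ → ℝ := fun t => (𝒩.F j).real {x | t * p < x.1 ∧ t ≤ x.2}
  have hηm : Measurable η := measurable_sojournSurvival p
  have hη0 : ∀ t, 0 ≤ η t := fun t => measureReal_nonneg
  have hη1 : ∀ t, |η t| ≤ 1 := fun t => by rw [abs_of_nonneg (hη0 t)]; exact measureReal_le_one
  have hsurv := survival_integrable (h.D_integrable j) (h.D_pos j)
  have hηi : IntegrableOn η (Ioi 0) := hsurv.1.mono' hηm.aestronglyMeasurable
    (Eventually.of_forall fun t => by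
      rw [Real.norm_of_nonneg (hη0 t)]
      exact measureReal_mono fun x hx => hx.2)
  have hηint : ∫ t in Ioi 0, η t = ∫ x, sojourn x.1 x.2 p ∂𝒩.F j :=
    integral_sojournSurvival hp0 (h.integrable_sojourn j hp0) (h.B_pos j) (h.D_pos j) hsurv.1
  have hl := h.lam_pos i j
  have heq : ∀ t, 0 ≤ t → z i j = z i j * (F₀ i j).real {x | t * p < x.1 ∧ t ≤ x.2}
      + 𝒩.lam i j * conv a η t := fun t ht => by
    have h1 := hsol.z_eq t ht i j
    simp only [intervalIntegral.integral_const, smul_eq_mul, sub_zero, ← hp] at h1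
    rw [conv, ← intervalIntegral.integral_const_mul]
    convert h1 using 2
    refine intervalIntegral.integral_congr fun s _ => ?_
    simp only [a, η, admission]
    split_ifs <;> ring
  have hlim : Tendsto (conv a η) atTop (𝓝 (z i j / 𝒩.lam i j)) := by
    have h1 : Tendsto (fun t => (F₀ i j).real {x : ℝ × ℝ | t * p < x.1 ∧ t ≤ x.2}) atTop (𝓝 0) :=
      squeeze_zero (fun t => measureReal_nonneg) (fun t => measureReal_mono fun x hx => hx.2)
        survival_tendsto_zero
    have h2 := ((h1.const_mul (z i j)).const_sub (z i j)).div_const (𝒩.lam i j)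
    rw [mul_zero, sub_zero] at h2
    refine h2.congr' ?_
    filter_upwards [eventually_ge_atTop 0] with t ht
    rw [div_eq_iff hl.ne']
    linarith [heq t ht]
  have h1 := tendsto_average (fun t ht => intervalIntegrable_conv ham ha1 hηm hη1 ht) hlim
  have h2 := tendsto_average_conv_sub ham ha1 hηm hη1 hη0 hηi
  have h3 := h1.sub (havg.mul_const (∫ t in Ioi 0, η t))
  have h4 := tendsto_nhds_unique h3 h2
  rw [hηint] at h4
  rw [h.gam_eq i j]
  rw [sub_eq_zero, div_eq_iff hl.ne'] at h4
  linarith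

end Network

end EVCharging

end

/-! ### The theorem. -/

theorem theorem1 {N T : Type*} [Fintype N] [Fintype T]
    (𝒩 : EVCharging.Network N T) (h𝒩 : 𝒩.Standing) :
    (∀ z : N → T → ℝ, 𝒩.IsInvariantPoint z → 𝒩.IsFixedPoint z) ∧
    ((∀ j, EVCharging.leftmost ((𝒩.F j).map (fun x => x.2 / x.1)) ≤ 1 / 𝒩.cmax j) →
      (∃ G : N → T → ℝ → EReal, ∀ i j, 𝒩.IsPrimitive i j (G i j)) ∧
      ∀ G : N → T → ℝ → EReal, (∀ i j, 𝒩.IsPrimitive i j (G i j)) →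
        (∀ i j, EVCharging.StrictConcaveOnE (Set.Icc 0 (𝒩.g i j (𝒩.cmax j))) (G i j)) ∧
        (∃! Λ : N → T → ℝ, 𝒩.IsOPFSolution G Λ) ∧
        (∃! z : N → T → ℝ, 𝒩.IsFixedPoint z) ∧
        ∀ z Λ : N → T → ℝ, 𝒩.IsFixedPoint z → 𝒩.IsOPFSolution G Λ →
          ∀ i j, z i j = Λ i j / 𝒩.gInv i j (Λ i j)) := by
  refine ⟨fun z hz => h𝒩.isFixedPoint_of_isInvariantPoint hz, fun hs => ?_⟩
  refine ⟨⟨fun i j => (h𝒩.exists_isPrimitive hs i j).choose,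
    fun i j => (h𝒩.exists_isPrimitive hs i j).choose_spec⟩, fun G hG => ?_⟩
  refine ⟨fun i j => ((hG i j).isMarginal h𝒩 hs).strictConcaveOnE, h𝒩.existsUnique_opf hs hG, ?_,
    fun z Λ hz hΛ => h𝒩.fixedPoint_eq hs hG hz hΛ⟩
  obtain ⟨Λ, hΛ⟩ := (h𝒩.existsUnique_opf hs hG).exists
  exact ⟨_, h𝒩.isFixedPoint_of_opf hs hG hΛ, fun z hz =>
    funext fun i => funext fun j => h𝒩.fixedPoint_eq hs hG hz hΛ i j⟩
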